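/- **Theorem.** Let $n\ge 3$ and let $X\subset\mathbb P^{n+2}=\mathbb P(V)$, $V=\mathbb C^{n+3}$, be the intersection of two quadrics $\varphi_1=0$, $\varphi_2=0$ which is nonsingular (the differentials of $\varphi_1,\varphi_2$ are linearly independent at each point of $X$). For $x\in X$ let $x^\perp\subset V$ be the affine tangent space of $X$ at $x$, $T_x(X)=x^\perp/\mathbb C x$, and let $II_{X,x}$ be the second fundamental form of $X$ at $x$, i.e. the linear system of quadrics on $T_x(X)$ given by the derivative at $x$ of the Gauss map $y\mapsto y^\perp$. A *pencil* of quadrics on a complex vector space $W$ is (the projectivization $\Phi$ of) a two-dimensional space $\widehat\Phi$ of quadratic forms on $W$; it is *nonsingular* if not all of its elements are degenerate and exactly $\dim W$ of the points of $\Phi\cong\mathbb P^1$ are degenerate. A *good pair* of a nonsingular pencil $\Phi$ is a pair of linearly independent nondegenerate forms $(\psi_1,\psi_2)$ spanning $\widehat\Phi$. A *standard basis* for it is a basis $w_1,\dots,w_m$ of $W$ with $\psi_1(\sum z_iw_i)=\sum\alpha_iz_i^2$ and $\psi_2(\sum z_iw_i)=\sum z_i^2$; then $[1:\alpha_i]$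 are the roots of the discriminant $\det(s\psi_1-t\psi_2)$, and $\alpha:W\to W$ denotes the diagonal operator $\sum z_iw_i\mapsto\sum\alpha_iz_iw_i$. A vector is *$(\psi_1,\psi_2)$-general* if all its coordinates in a standard basis are nonzero. A three-dimensional subspace $P\subset W$ is *poised by* $\Phi$ if, for some good pair of $\Phi$, $P=\operatorname{span}\{u,\alpha(u),\alpha^2(u)\}$ for a $(\psi_1,\psi_2)$-general vector $u$. Let $\mathcal M^{\rm PQ}_n$ be the moduli space of nonsingular pencils of quadrics on an $n$-dimensional space up to linear isomorphism, with its structure of a quotient (a function on an open subset is holomorphic if its pull-back to pairs of quadratic forms on $\mathbb C^n$ spanning a nonsingular pencil is holomorphic), let $X^o\subset X$ be the open set of the points at which $II_{X,x}$ is a nonsingular pencil, and let $\mu^X:X^o\to\mathcal M^{\rm PQ}_n$, $x\mapsto[II_{X,x}]$. The kernel $\operatorname{Ker}(d_x\mu^X)$ is the set of $v\in T_x(X)$ such that $d_x(f\circ\mu^X)(v)=0$ for every function $f$ holomorphic near $\mu^X(x)$. Let $x\in X$ be *regular*, that is: (i) $x$ is $(\psi_1,\psi_2)$-general for a good pair $(\psi_1,\psi_2)$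 of the pencil spanned by $\varphi_1,\varphi_2$, (ii) $II_{X,x}$ is a nonsingular pencil, (iii) the projective automorphisms of $II_{X,x}\cong\mathbb P^1$ preserving the set of its $n$ degenerate elements are only those which exist for every set of $n$ points (for $n\ge5$: only the identity; for $n=4$: only automorphisms $g$ with $g^2=1$; for $n=3$: no condition), and (iv) the forms induced by $\psi_1$ and $\psi_2$ on $T_x(X)$ are nondegenerate. Then $\mathcal P_x=\operatorname{Ker}(d_x\mu^X)$ is a three-dimensional vector subspace of $T_x(X)$, and it is poised by $II_{X,x}$. -/

import Mathlib

open Filter Topology LinearAlgebra.Projectivization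

noncomputable section

namespace PencilsOfQuadrics

/-! ### Quadratic forms and pencils of quadrics -/

section Pencils

variable {W : Type*} [AddCommGroup W] [Module ℂ W]

/-- A quadratic form is degenerate if its singular space `{u | B_φ(u, ·) = 0}` is nontrivial. -/
def IsDegenerate (φ : QuadraticForm ℂ W) : Prop :=
  ∃ u : W, u ≠ 0 ∧ ∀ v : W, QuadraticMap.associated φ u v = 0

/-- The degenerate elements of the projective line `ℙ Φ`, for a linear system `Φ` of quadratic
forms (given by the corresponding linear subspace of the space of quadratic forms). -/
def degeneratePoints (Φ : Submodule ℂ (QuadraticForm ℂ W)) : Set (ℙ ℂ Φ) :=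
  {p | IsDegenerate (p.rep : QuadraticForm ℂ W)}

/-- `Φ` is a nonsingular pencil of quadrics on `W`: it is a pencil, not all of its elements are
degenerate, and it has exactly `dim W` distinct degenerate elements. -/
structure IsNonsingularPencil (Φ : Submodule ℂ (QuadraticForm ℂ W)) : Prop where
  finrank_eq : Module.finrank ℂ Φ = 2
  nondegenerate : ∃ φ ∈ Φ, ¬ IsDegenerate φ
  ncard_eq : (degeneratePoints Φ).ncard = Module.finrank ℂ W

/-- A good pair of `Φ`: two linearly independent nondegenerate quadratic forms which generate
the nonsingular pencil `Φ`. -/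
structure IsGoodPair (Φ : Submodule ℂ (QuadraticForm ℂ W)) (φ₁ φ₂ : QuadraticForm ℂ W) :
    Prop where
  linearIndependent : LinearIndependent ℂ ![φ₁, φ₂]
  nondegenerate₁ : ¬ IsDegenerate φ₁
  nondegenerate₂ : ¬ IsDegenerate φ₂
  span_eq : Submodule.span ℂ {φ₁, φ₂} = Φ
  nonsingular : IsNonsingularPencil Φ

/-- `b` is a standard basis for the pair `(φ₁, φ₂)`, and `[1 : α i]` are the roots of the
discriminant `det (s φ₁ - t φ₂)`: in the coordinates of `b`, `φ₁ = ∑ αᵢ zᵢ²`, `φ₂ = ∑ zᵢ²`. -/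
def IsStandardBasis (φ₁ φ₂ : QuadraticForm ℂ W)
    (b : Module.Basis (Fin (Module.finrank ℂ W)) ℂ W) (α : Fin (Module.finrank ℂ W) → ℂ) :
    Prop :=
  (∀ z : Fin (Module.finrank ℂ W) → ℂ, φ₁ (∑ i, z i • b i) = ∑ i, α i * z i ^ 2) ∧
  (∀ z : Fin (Module.finrank ℂ W) → ℂ, φ₂ (∑ i, z i • b i) = ∑ i, z i ^ 2)

/-- `u` is `(φ₁, φ₂)`-general: all its coordinates in a standard basis are nonzero. -/
def IsGeneralVector (φ₁ φ₂ : QuadraticForm ℂ W) (u : W) : Prop :=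
  ∃ b α, IsStandardBasis φ₁ φ₂ b α ∧ ∀ i, b.repr u i ≠ 0

/-- The diagonal operator `∑ zᵢ bᵢ ↦ ∑ αᵢ zᵢ bᵢ`. -/
def diagonalOperator {ι : Type*} (b : Module.Basis ι ℂ W) (α : ι → ℂ) : W →ₗ[ℂ] W :=
  b.constr ℂ fun i => α i • b i

/-- `P` is poised by the pair `(φ₁, φ₂)`: it is spanned by `u, α(u), α²(u)` for some
`(φ₁, φ₂)`-general vector `u`, where `α` is the diagonal operator attached to the pair. -/
def IsPoisedByPair (φ₁ φ₂ : QuadraticForm ℂ W) (P : Submodule ℂ W) : Prop :=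
  ∃ b α, IsStandardBasis φ₁ φ₂ b α ∧ ∃ u : W, (∀ i, b.repr u i ≠ 0) ∧
    P = Submodule.span ℂ
      {u, diagonalOperator b α u, diagonalOperator b α (diagonalOperator b α u)}

/-- `P` is poised by the nonsingular pencil `Φ`: it is a three-dimensional subspace poised by a
good pair of `Φ`. -/
def IsPoised (Φ : Submodule ℂ (QuadraticForm ℂ W)) (P : Submodule ℂ W) : Prop :=
  Module.finrank ℂ P = 3 ∧ ∃ φ₁ φ₂, IsGoodPair Φ φ₁ φ₂ ∧ IsPoisedByPair φ₁ φ₂ P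

/-- The pencil `Φ` is general: the projective automorphisms of `ℙ Φ` preserving the set of the
degenerate elements are only those which exist for every choice of that set. When `dim W ≥ 5`,
this is the identity only. Any four points of a projective line are preserved by a Klein four
group of projective involutions, and any three points by a symmetric group, so for `dim W = 4` the
condition is that there are involutions only, and for `dim W = 3` there is no condition. -/
def IsGeneralPencil (Φ : Submodule ℂ (QuadraticForm ℂ W)) : Prop :=
  ∀ g : Φ ≃ₗ[ℂ] Φ,
    (∀ p, Projectivization.map (g : Φ →ₗ[ℂ] Φ) g.injective p ∈ degeneratePoints Φ ↔
      p ∈ degeneratePoints Φ) →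
    (5 ≤ Module.finrank ℂ W →
      ∀ p, Projectivization.map (g : Φ →ₗ[ℂ] Φ) g.injective p = p) ∧
    (Module.finrank ℂ W = 4 →
      ∀ p, Projectivization.map (g : Φ →ₗ[ℂ] Φ) g.injective
        (Projectivization.map (g : Φ →ₗ[ℂ] Φ) g.injective p) = p)

/-! ### Projective equivalence and the moduli of nonsingular pencils -/

variable {W' : Type*} [AddCommGroup W'] [Module ℂ W']

/-- Pull-back of quadratic forms along a linear isomorphism. -/
def pullbackForm (e : W' ≃ₗ[ℂ] W) : QuadraticForm ℂ W ≃ₗ[ℂ] QuadraticForm ℂ W' where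
  toFun φ := φ.comp (e : W' →ₗ[ℂ] W)
  invFun φ := φ.comp (e.symm : W →ₗ[ℂ] W')
  map_add' _ _ := rfl
  map_smul' _ _ := rfl
  left_inv φ := by ext v; simp
  right_inv φ := by ext v; simp

/-- Pull-back of pencils along a linear isomorphism. -/
def pullbackPencil (e : W' ≃ₗ[ℂ] W) (Φ : Submodule ℂ (QuadraticForm ℂ W)) :
    Submodule ℂ (QuadraticForm ℂ W') :=
  Φ.map (pullbackForm e : QuadraticForm ℂ W →ₗ[ℂ] QuadraticForm ℂ W')

@[simp]
theorem pullbackForm_apply (e : W' ≃ₗ[ℂ] W) (φ : QuadraticForm ℂ W) (v : W') :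
    pullbackForm e φ v = φ (e v) := rfl

theorem mem_pullbackPencil (e : W' ≃ₗ[ℂ] W) (Φ : Submodule ℂ (QuadraticForm ℂ W))
    (ψ : QuadraticForm ℂ W') :
    ψ ∈ pullbackPencil e Φ ↔ ∃ φ ∈ Φ, ∀ v, φ (e v) = ψ v := by
  rw [pullbackPencil, Submodule.mem_map]
  exact ⟨fun ⟨φ, hφ, h⟩ => ⟨φ, hφ, fun v => by rw [← h]; rfl⟩,
    fun ⟨φ, hφ, h⟩ => ⟨φ, hφ, QuadraticMap.ext h⟩⟩

theorem pullbackPencil_refl (Φ : Submodule ℂ (QuadraticForm ℂ W)) :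
    pullbackPencil (LinearEquiv.refl ℂ W) Φ = Φ := by
  ext ψ
  rw [mem_pullbackPencil]
  constructor
  · rintro ⟨φ, hφ, h⟩
    rwa [← show φ = ψ from QuadraticMap.ext h]
  · exact fun h => ⟨ψ, h, fun _ => rfl⟩

theorem pullbackPencil_trans {W'' : Type*} [AddCommGroup W''] [Module ℂ W'']
    (d : W'' ≃ₗ[ℂ] W') (e : W' ≃ₗ[ℂ] W) (Φ : Submodule ℂ (QuadraticForm ℂ W)) :
    pullbackPencil d (pullbackPencil e Φ) = pullbackPencil (d.trans e) Φ := by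
  ext ψ
  simp only [mem_pullbackPencil]
  constructor
  · rintro ⟨φ, ⟨θ, hθ, h⟩, h'⟩
    exact ⟨θ, hθ, fun v => (h _).trans (h' v)⟩
  · rintro ⟨θ, hθ, h⟩
    exact ⟨pullbackForm e θ, ⟨θ, hθ, fun _ => rfl⟩, h⟩

theorem isDegenerate_pullbackForm (e : W' ≃ₗ[ℂ] W) (φ : QuadraticForm ℂ W) :
    IsDegenerate (pullbackForm e φ) ↔ IsDegenerate φ := by
  have key : ∀ u v : W', QuadraticMap.associated (pullbackForm e φ) u v =
      QuadraticMap.associated φ (e u) (e v) := by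
    intro u v
    have happ : ∀ w, pullbackForm e φ w = φ (e w) := fun _ => rfl
    simp [QuadraticMap.associated_apply, happ]
  constructor
  · rintro ⟨u, hu, h⟩
    refine ⟨e u, by simpa using hu, fun v => ?_⟩
    rw [← e.apply_symm_apply v, ← key, h]
  · rintro ⟨u, hu, h⟩
    refine ⟨e.symm u, by simpa using hu, fun v => ?_⟩
    rw [key, e.apply_symm_apply, h]

theorem isDegenerate_smul {a : ℂ} (ha : a ≠ 0) (φ : QuadraticForm ℂ W) :
    IsDegenerate (a • φ) ↔ IsDegenerate φ := by
  simp [IsDegenerate, ha]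

theorem mk_mem_degeneratePoints (Φ : Submodule ℂ (QuadraticForm ℂ W)) (φ : Φ) (h : φ ≠ 0) :
    Projectivization.mk ℂ φ h ∈ degeneratePoints Φ ↔ IsDegenerate (φ : QuadraticForm ℂ W) := by
  obtain ⟨a, ha⟩ := Projectivization.exists_smul_eq_mk_rep ℂ φ h
  rw [degeneratePoints, Set.mem_ofPred_eq, ← ha]
  exact isDegenerate_smul a.ne_zero _

theorem IsNonsingularPencil.pullback (e : W' ≃ₗ[ℂ] W) {Φ : Submodule ℂ (QuadraticForm ℂ W)}
    (h : IsNonsingularPencil Φ) : IsNonsingularPencil (pullbackPencil e Φ) := by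
  refine ⟨?_, ?_, ?_⟩
  · rw [pullbackPencil, LinearEquiv.finrank_map_eq, h.finrank_eq]
  · obtain ⟨φ, hφ, hd⟩ := h.nondegenerate
    exact ⟨pullbackForm e φ, Submodule.mem_map_of_mem hφ, by
      rwa [isDegenerate_pullbackForm]⟩
  · rw [e.finrank_eq, ← h.ncard_eq]
    let E : Φ ≃ₗ[ℂ] pullbackPencil e Φ := (pullbackForm e).submoduleMap Φ
    let F : ℙ ℂ Φ → ℙ ℂ (pullbackPencil e Φ) :=
      Projectivization.map (E : Φ →ₗ[ℂ] pullbackPencil e Φ) E.injective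
    have hF : Function.Injective F := Projectivization.map_injective _ E.injective
    have himg : degeneratePoints (pullbackPencil e Φ) = F '' degeneratePoints Φ := by
      have hmem : ∀ p, F p ∈ degeneratePoints (pullbackPencil e Φ) ↔
          p ∈ degeneratePoints Φ := by
        intro p
        induction p using Projectivization.ind with
        | h v hv =>
          simp only [F, Projectivization.map_mk]
          rw [mk_mem_degeneratePoints, mk_mem_degeneratePoints]
          exact isDegenerate_pullbackForm e _
      ext p
      constructor
      · intro hp
        obtain ⟨q, rfl⟩ : ∃ q, F q = p := by
          induction p using Projectivization.ind with
          | h v hv =>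
            refine ⟨Projectivization.mk ℂ (E.symm v) (by simpa using hv), ?_⟩
            simp [F, Projectivization.map_mk]
        exact ⟨q, (hmem q).1 hp, rfl⟩
      · rintro ⟨q, hq, rfl⟩
        exact (hmem q).2 hq
    rw [himg, Set.ncard_image_of_injective _ hF]

end Pencils

/-- Projective equivalence of nonsingular pencils of quadrics on `ℂⁿ`. -/
def pencilSetoid (n : ℕ) :
    Setoid {Φ : Submodule ℂ (QuadraticForm ℂ (Fin n → ℂ)) // IsNonsingularPencil Φ} where
  r Φ Ψ := ∃ T : (Fin n → ℂ) ≃ₗ[ℂ] (Fin n → ℂ), Ψ.1 = pullbackPencil T Φ.1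
  iseqv := by
    refine ⟨fun Φ => ⟨LinearEquiv.refl ℂ _, (pullbackPencil_refl _).symm⟩, ?_, ?_⟩
    · rintro Φ Ψ ⟨T, hT⟩
      refine ⟨T.symm, ?_⟩
      rw [hT, pullbackPencil_trans, LinearEquiv.symm_trans_self, pullbackPencil_refl]
    · rintro Φ Ψ Θ ⟨T, hT⟩ ⟨S, hS⟩
      exact ⟨S.trans T, by rw [hS, hT, pullbackPencil_trans]⟩

/-- The moduli of nonsingular pencils of quadrics on an `n`-dimensional complex vector space:
the orbit space of nonsingular pencils modulo projective equivalence. -/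
def ModuliPQ (n : ℕ) : Type := Quotient (pencilSetoid n)

/-- The class in the moduli space of a nonsingular pencil on any vector space of dimension `n`,
through a linear isomorphism with `ℂⁿ`, the choice of which does not matter. -/
def moduliClass {W : Type*} [AddCommGroup W] [Module ℂ W] [Module.Finite ℂ W] {n : ℕ}
    (hW : Module.finrank ℂ W = n) (Φ : Submodule ℂ (QuadraticForm ℂ W))
    (hΦ : IsNonsingularPencil Φ) : ModuliPQ n :=
  Quotient.mk (pencilSetoid n)
    ⟨pullbackPencil (Module.finBasisOfFinrankEq ℂ W hW).equivFun.symm Φ, hΦ.pullback _⟩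

theorem moduliClass_eq {W : Type*} [AddCommGroup W] [Module ℂ W] [Module.Finite ℂ W] {n : ℕ}
    (hW : Module.finrank ℂ W = n) (Φ : Submodule ℂ (QuadraticForm ℂ W))
    (hΦ : IsNonsingularPencil Φ) (e : (Fin n → ℂ) ≃ₗ[ℂ] W) :
    moduliClass hW Φ hΦ = Quotient.mk (pencilSetoid n) ⟨pullbackPencil e Φ, hΦ.pullback e⟩ := by
  refine Quotient.sound
    ⟨e.trans (Module.finBasisOfFinrankEq ℂ W hW).equivFun, ?_⟩
  rw [pullbackPencil_trans, LinearEquiv.trans_assoc, LinearEquiv.self_trans_symm,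
    LinearEquiv.trans_refl]

/-- The linear system on `ℂⁿ` generated by the two quadratic forms `∑ Aᵢⱼ zᵢ zⱼ` and
`∑ Bᵢⱼ zᵢ zⱼ`. -/
def coefficientPencil {n : ℕ} (AB : (Fin n → Fin n → ℂ) × (Fin n → Fin n → ℂ)) :
    Submodule ℂ (QuadraticForm ℂ (Fin n → ℂ)) :=
  Submodule.span ℂ
    {(Matrix.of AB.1).toQuadraticForm', (Matrix.of AB.2).toQuadraticForm'}

/-- The set of the pairs of coefficient arrays which generate a nonsingular pencil whose class
lies in `U`. -/
def coefficientPreimage {n : ℕ} (U : Set (ModuliPQ n)) :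
    Set ((Fin n → Fin n → ℂ) × (Fin n → Fin n → ℂ)) :=
  {AB | ∃ h : IsNonsingularPencil (coefficientPencil AB),
    Quotient.mk (pencilSetoid n) ⟨coefficientPencil AB, h⟩ ∈ U}

open Classical in
/-- A function on the moduli space, pulled back to pairs of coefficient arrays (and extended by
`0` to the pairs which do not generate a nonsingular pencil). -/
def coefficientPullback {n : ℕ} (f : ModuliPQ n → ℂ)
    (AB : (Fin n → Fin n → ℂ) × (Fin n → Fin n → ℂ)) : ℂ :=
  if h : IsNonsingularPencil (coefficientPencil AB) then
    f (Quotient.mk (pencilSetoid n) ⟨coefficientPencil AB, h⟩) else 0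

/-- `f` is a holomorphic function near the point `m` of the moduli space, for the structure of a
quotient: on some neighbourhood of `m`, open for the quotient topology, its pull-back is
holomorphic. -/
def IsHolomorphicNear {n : ℕ} (f : ModuliPQ n → ℂ) (m : ModuliPQ n) : Prop :=
  ∃ U : Set (ModuliPQ n), m ∈ U ∧ IsOpen (coefficientPreimage U) ∧
    DifferentiableOn ℂ (coefficientPullback f) (coefficientPreimage U)

/-! ### Intersections of two quadrics in `ℙⁿ⁺²` and their second fundamental forms

Points of projective space are given by homogeneous coordinate vectors. -/

section Intersection

variable {n : ℕ} (φ₁ φ₂ : QuadraticForm ℂ (Fin (n + 3) → ℂ))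

/-- The affine cone, without its vertex, of the intersection `X` of the two quadrics. -/
def cone : Set (Fin (n + 3) → ℂ) := {x | x ≠ 0 ∧ φ₁ x = 0 ∧ φ₂ x = 0}

/-- The intersection of the two quadrics is nonsingular (of dimension `n`), by the Jacobian
criterion: the differentials of the two equations are independent at each of its points. -/
def IsNonsingularIntersection : Prop :=
  ∀ x ∈ cone φ₁ φ₂,
    LinearIndependent ℂ ![QuadraticMap.associated φ₁ x, QuadraticMap.associated φ₂ x]

/-- The affine tangent space at `x`, the kernel `x^⊥` of the differentials of the equations. -/
def affineTangent (x : Fin (n + 3) → ℂ) : Submodule ℂ (Fin (n + 3) → ℂ) :=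
  LinearMap.ker (QuadraticMap.associated φ₁ x) ⊓ LinearMap.ker (QuadraticMap.associated φ₂ x)

/-- The tangent space `T_x(X) = x^⊥ / ℂ x` of `X ⊆ ℙⁿ⁺²`. -/
abbrev TangentSpace (x : Fin (n + 3) → ℂ) : Type :=
  affineTangent φ₁ φ₂ x ⧸ (Submodule.span ℂ {x}).submoduleOf (affineTangent φ₁ φ₂ x)

/-- The class in `T_x(X)` of a vector of the affine tangent space. -/
abbrev tangentClass {x : Fin (n + 3) → ℂ} (v : affineTangent φ₁ φ₂ x) : TangentSpace φ₁ φ₂ x :=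
  Submodule.Quotient.mk v

/-- The second fundamental form of `X` at `x`, as a linear system of quadrics on `T_x(X)`.

The derivative at `x` of the Gauss map `y ↦ affineTangent y`, in the direction of `y'(0)` for a
holomorphic curve `y` on the cone through `x`, is the linear map from the affine tangent space to
the normal space `N` which sends `w(0)` to the class of `w'(0)`, for each holomorphic family of
vectors `w(t)` tangent at `y(t)`. The linear system consists of the quadratic forms whose
associated bilinear forms are the compositions of this derivative with the linear forms `ℓ`
on `N`. -/
def secondFundamentalForm (x : Fin (n + 3) → ℂ) :
    Submodule ℂ (QuadraticForm ℂ (TangentSpace φ₁ φ₂ x)) where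
  carrier := {ψ | ∃ ℓ : Module.Dual ℂ (Fin (n + 3) → ℂ),
    (∀ u ∈ affineTangent φ₁ φ₂ x, ℓ u = 0) ∧
    ∀ y w : ℂ → Fin (n + 3) → ℂ, AnalyticAt ℂ y 0 → AnalyticAt ℂ w 0 → y 0 = x →
      (∀ᶠ t in 𝓝 (0 : ℂ), y t ∈ cone φ₁ φ₂ ∧ w t ∈ affineTangent φ₁ φ₂ (y t)) →
      ∀ v₀ w₀ : affineTangent φ₁ φ₂ x, deriv y 0 = v₀ → w 0 = w₀ →
        QuadraticMap.associated ψ (tangentClass φ₁ φ₂ v₀) (tangentClass φ₁ φ₂ w₀) =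
          ℓ (deriv w 0)}
  zero_mem' := ⟨0, by simp, by intros; simp⟩
  add_mem' := by
    rintro ψ ψ' ⟨ℓ, hℓ, h⟩ ⟨ℓ', hℓ', h'⟩
    refine ⟨ℓ + ℓ', fun u hu => by simp [hℓ u hu, hℓ' u hu], ?_⟩
    intro y w hy hw h0 hyw v₀ w₀ hv hw₀
    rw [map_add, LinearMap.add_apply, LinearMap.add_apply, LinearMap.add_apply,
      h y w hy hw h0 hyw v₀ w₀ hv hw₀, h' y w hy hw h0 hyw v₀ w₀ hv hw₀]
  smul_mem' := by
    rintro c ψ ⟨ℓ, hℓ, h⟩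
    refine ⟨c • ℓ, fun u hu => by simp [hℓ u hu], ?_⟩
    intro y w hy hw h0 hyw v₀ w₀ hv hw₀
    rw [map_smul, LinearMap.smul_apply, LinearMap.smul_apply, LinearMap.smul_apply,
      h y w hy hw h0 hyw v₀ w₀ hv hw₀]

/-- The (cone over the) open subset `X^o` of `X` on which the second fundamental form is a
nonsingular pencil. -/
def openLocus : Set (Fin (n + 3) → ℂ) :=
  {x | x ∈ cone φ₁ φ₂ ∧ IsNonsingularPencil (secondFundamentalForm φ₁ φ₂ x)}

variable {φ₁ φ₂}

theorem finrank_tangentSpace (hX : IsNonsingularIntersection φ₁ φ₂) {x : Fin (n + 3) → ℂ}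
    (hx : x ∈ cone φ₁ φ₂) : Module.finrank ℂ (TangentSpace φ₁ φ₂ x) = n := by
  have hli := hX x hx
  obtain ⟨hx0, hx1, hx2⟩ := hx
  have hmem : x ∈ affineTangent φ₁ φ₂ x := by
    rw [affineTangent, Submodule.mem_inf, LinearMap.mem_ker, LinearMap.mem_ker,
      QuadraticMap.associated_eq_self_apply, QuadraticMap.associated_eq_self_apply]
    exact ⟨hx1, hx2⟩
  have hle : Submodule.span ℂ {x} ≤ affineTangent φ₁ φ₂ x := by
    simpa [Submodule.span_singleton_le_iff_mem] using hmem
  have h1 : Module.finrank ℂ ((Submodule.span ℂ {x}).submoduleOf (affineTangent φ₁ φ₂ x)) = 1 := by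
    rw [(Submodule.submoduleOfEquivOfLe hle).finrank_eq, finrank_span_singleton hx0]
  have h2 : Module.finrank ℂ (affineTangent φ₁ φ₂ x) = n + 1 := by
    have hann : affineTangent φ₁ φ₂ x = (Submodule.span ℂ (Set.range
        ![QuadraticMap.associated φ₁ x, QuadraticMap.associated φ₂ x])).dualCoannihilator := by
      ext v
      rw [Submodule.mem_dualCoannihilator, affineTangent, Submodule.mem_inf, LinearMap.mem_ker,
        LinearMap.mem_ker]
      constructor
      · rintro ⟨h, h'⟩ θ hθ
        induction hθ using Submodule.span_induction with
        | mem θ hθ =>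
          obtain ⟨i, rfl⟩ := hθ
          fin_cases i
          · exact h
          · exact h'
        | zero => rfl
        | add θ θ' _ _ h h' => rw [LinearMap.add_apply, h, h', add_zero]
        | smul c θ _ h => rw [LinearMap.smul_apply, h, smul_zero]
      · intro h
        exact ⟨h _ (Submodule.subset_span ⟨0, rfl⟩), h _ (Submodule.subset_span ⟨1, rfl⟩)⟩
    have := Subspace.finrank_add_finrank_dualCoannihilator_eq (Submodule.span ℂ (Set.range
        ![QuadraticMap.associated φ₁ x, QuadraticMap.associated φ₂ x]))
    rw [← hann, finrank_span_eq_card hli] at this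
    simp at this
    omega
  have := Submodule.finrank_quotient_add_finrank
    ((Submodule.span ℂ {x}).submoduleOf (affineTangent φ₁ φ₂ x))
  rw [h1, h2] at this
  exact Nat.succ_injective this

/-- The moduli map `μ^X : X^o → ModuliPQ n` of second fundamental forms. -/
def moduliMap (hX : IsNonsingularIntersection φ₁ φ₂) (x : openLocus φ₁ φ₂) : ModuliPQ n :=
  moduliClass (finrank_tangentSpace hX x.2.1) (secondFundamentalForm φ₁ φ₂ x) x.2.2

open Classical in
/-- The function `f ∘ μ^X`, extended by `0` outside of `X^o`. -/
def moduliPullback (hX : IsNonsingularIntersection φ₁ φ₂) (f : ModuliPQ n → ℂ)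
    (x : Fin (n + 3) → ℂ) : ℂ :=
  if h : x ∈ openLocus φ₁ φ₂ then f (moduliMap hX ⟨x, h⟩) else 0

/-- The kernel of the differential `d_x μ^X`, as a set of tangent vectors: `v` lies in it if the
derivative of `f ∘ μ^X` at `x` in the direction `v` vanishes for each function `f` which is
holomorphic near `μ^X(x)`. Derivatives are taken along holomorphic curves on `X` through `x`. -/
def kerDifferential (hX : IsNonsingularIntersection φ₁ φ₂) (x : openLocus φ₁ φ₂) :
    Set (TangentSpace φ₁ φ₂ (x : Fin (n + 3) → ℂ)) :=
  {v | ∀ f : ModuliPQ n → ℂ, IsHolomorphicNear f (moduliMap hX x) →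
    ∀ y : ℂ → Fin (n + 3) → ℂ, AnalyticAt ℂ y 0 → y 0 = x →
      (∀ᶠ t in 𝓝 (0 : ℂ), y t ∈ cone φ₁ φ₂) →
      ∀ v₀ : affineTangent φ₁ φ₂ (x : Fin (n + 3) → ℂ), deriv y 0 = v₀ →
        tangentClass φ₁ φ₂ v₀ = v →
          HasDerivAt (fun t => moduliPullback hX f (y t)) 0 0}

variable (φ₁ φ₂)

/-- `x` is a regular point of `X`. -/
structure IsRegularPoint (x : Fin (n + 3) → ℂ) : Prop where
  mem_cone : x ∈ cone φ₁ φ₂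
  /-- For some choice of two nondegenerate forms generating the pencil of `X`, all the coordinates
  of `x` in a standard basis are nonzero, and the two forms induce nondegenerate forms on
  `T_x(X)`. -/
  general : ∃ ψ₁ ψ₂, IsGoodPair (Submodule.span ℂ {φ₁, φ₂}) ψ₁ ψ₂ ∧ IsGeneralVector ψ₁ ψ₂ x ∧
    ∀ ψ ∈ ({ψ₁, ψ₂} : Set (QuadraticForm ℂ (Fin (n + 3) → ℂ))),
      ∀ u ∈ affineTangent φ₁ φ₂ x,
        (∀ w ∈ affineTangent φ₁ φ₂ x, QuadraticMap.associated ψ u w = 0) →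
          u ∈ Submodule.span ℂ {x}
  nonsingular : IsNonsingularPencil (secondFundamentalForm φ₁ φ₂ x)
  generalPencil : IsGeneralPencil (secondFundamentalForm φ₁ φ₂ x)

variable {φ₁ φ₂}

theorem IsRegularPoint.mem_openLocus {x : Fin (n + 3) → ℂ} (hx : IsRegularPoint φ₁ φ₂ x) :
    x ∈ openLocus φ₁ φ₂ :=
  ⟨hx.mem_cone, hx.nonsingular⟩

end Intersection

end PencilsOfQuadrics

end

/-! Diagonalize: `ψ₁ = ∑ αᵢ zᵢ²`, `ψ₂ = ∑ zᵢ²`. Differentiating the tangency equations along a curve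
on the cone shows that the second fundamental form at `x` is the pencil induced by `ψ₁, ψ₂` on `x^⊥
/ ℂ x`. Its discriminant roots `l k` are the zeros of `∑ xᵢ² / (αᵢ - μ)`, with eigenvectors `(α - l
k)⁻¹ x`. These are orthogonal for both forms; with `d k ^ 2 = ∑ xᵢ² / (αᵢ - l k)²`, dividing them by
`d k` gives a standard basis `e` of the tangent space.

Implicit differentiation of the root equation along a curve with velocity `v` expresses `l k'` by
the sum `∑ xᵢ vᵢ / (αᵢ - l k)`. That sum is also `d k` times the `k`-th coordinate of `v` in `e`, so
`l k' * d k = -2 v_k`.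

The class of the pencil depends only on the roots modulo projective transformations, whose
infinitesimal action is `l k' = a + b l k + c l k ²`. Thus `v` lies in the kernel exactly when `v_k
= d k (a + b l k + c l k ²)`, that is, when `v` is in the span of `u, α u, α² u` with `u = ∑ d k e
k`. This span is three-dimensional because the roots are distinct and all `d k` are nonzero.

One inclusion is the invariance of functions on the moduli space (`diagonalClass_moebius`,
`fderiv_coefficientPullback_diagonalPair`). The other needs enough functions: every velocity
transverse to the projective orbit must be detected. This is done by averaging over permutations a
function of cross-ratios (`exists_invariant_derivative_ne_zero`), where generality of the pencil
keeps the average from cancelling. The average is holomorphic on the moduli space because simple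
roots depend holomorphically on the coefficients (`exists_holomorphic_of_moebius_invariant`). The
geometric input is `IsDiagonalFrame.exists_isTangentRoot` and `IsDiagonalFrame.exists_root_curve`;
both halves meet in `IsDiagonalFrame.kerDifferential_eq`. -/

namespace PencilsOfQuadrics

/-! ### Roots of the discriminant of a pencil. -/

section Roots

variable {W : Type*} [AddCommGroup W] [Module ℂ W]

theorem isDegenerate_sub_smul_iff {θ₁ θ₂ : QuadraticForm ℂ W} {μ : ℂ} :
    IsDegenerate (θ₁ - μ • θ₂) ↔ ∃ u : W, u ≠ 0 ∧ ∀ v,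
      QuadraticMap.associated θ₁ u v = μ * QuadraticMap.associated θ₂ u v := by
  simp only [IsDegenerate, map_sub, map_smul, LinearMap.sub_apply, LinearMap.smul_apply,
    smul_eq_mul, sub_eq_zero]

/-- Nondegeneracy of `θ₂` turns `θ₁` into an operator `A`, so that degenerate members `θ₁ - μ θ₂`
correspond to eigenvalues of `A`. -/
theorem exists_endomorphism_associated [Module.Finite ℂ W] (θ₁ : QuadraticForm ℂ W)
    {θ₂ : QuadraticForm ℂ W} (h : ¬ IsDegenerate θ₂) :
    ∃ A : Module.End ℂ W, ∀ u v,
      QuadraticMap.associated θ₂ (A u) v = QuadraticMap.associated θ₁ u v := by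
  have hsymm : ∀ u v, QuadraticMap.associated θ₂ u v = QuadraticMap.associated θ₂ v u :=
    fun u v => QuadraticMap.associated_isSymm ℂ θ₂ u v
  have hnd : ∀ u, (∀ v, QuadraticMap.associated θ₂ u v = 0) → u = 0 := by
    intro u hu
    by_contra hne
    exact h ⟨u, hne, hu⟩
  have hB : LinearMap.BilinForm.Nondegenerate (QuadraticMap.associated θ₂) :=
    ⟨hnd, fun u hu => hnd u fun v => by rw [hsymm]; exact hu v⟩
  exact ⟨LinearMap.BilinForm.symmCompOfNondegenerate (QuadraticMap.associated θ₁) _ hB,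
    fun u v => LinearMap.BilinForm.symmCompOfNondegenerate_left_apply _ hB v u⟩

theorem linearIndependent_of_associated_eq [Module.Finite ℂ W] {κ : Type*}
    {θ₁ θ₂ : QuadraticForm ℂ W} (h : ¬ IsDegenerate θ₂) {l : κ → ℂ} (hl : Function.Injective l)
    {e : κ → W} (he : ∀ k, e k ≠ 0)
    (hle : ∀ k v, QuadraticMap.associated θ₁ (e k) v =
      l k * QuadraticMap.associated θ₂ (e k) v) : LinearIndependent ℂ e := by
  obtain ⟨A, hA⟩ := exists_endomorphism_associated θ₁ h
  refine Module.End.eigenvectors_linearIndependent' A l hl e fun k => ?_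
  rw [Module.End.hasEigenvector_iff, Module.End.mem_eigenspace_iff]
  refine ⟨?_, he k⟩
  by_contra hne
  refine h ⟨A (e k) - l k • e k, sub_ne_zero.2 hne, fun v => ?_⟩
  rw [map_sub, LinearMap.sub_apply, hA, hle]
  simp

/-- The degenerate elements of the pencil `Φ` generated by `θ₁` and the nondegenerate form `θ₂`
include the `n` distinct ones `θ₁ - lₖ θ₂`. -/
structure HasRoots {n : ℕ} (Φ : Submodule ℂ (QuadraticForm ℂ W)) (θ₁ θ₂ : QuadraticForm ℂ W)
    (l : Fin n → ℂ) : Prop where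
  span_eq : Submodule.span ℂ {θ₁, θ₂} = Φ
  nondegenerate : ¬ IsDegenerate θ₂
  injective : Function.Injective l
  degenerate : ∀ k, IsDegenerate (θ₁ - l k • θ₂)

variable {n : ℕ} {Φ : Submodule ℂ (QuadraticForm ℂ W)} {θ₁ θ₂ : QuadraticForm ℂ W}
  {l : Fin n → ℂ}

/-- A further root would yield `n + 1` eigenvectors with distinct eigenvalues, hence `n + 1`
independent vectors. The extra root is indexed by `none`. -/
theorem HasRoots.exists_eq [Module.Finite ℂ W] (hW : Module.finrank ℂ W = n)
    (h : HasRoots Φ θ₁ θ₂ l) {μ : ℂ} (hμ : IsDegenerate (θ₁ - μ • θ₂)) : ∃ k, l k = μ := by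
  by_contra hne
  push Not at hne
  have hd : ∀ k : Option (Fin n), IsDegenerate (θ₁ - (k.elim μ l) • θ₂)
    | none => hμ
    | some k => h.degenerate k
  have hinj : Function.Injective fun k : Option (Fin n) => k.elim μ l := by
    rintro (_ | i) (_ | j) hij
    · rfl
    · exact absurd hij.symm (hne j)
    · exact absurd hij (hne i)
    · exact congrArg _ (h.injective hij)
  choose e he hle using fun k => isDegenerate_sub_smul_iff.1 (hd k)
  have := (linearIndependent_of_associated_eq h.nondegenerate hinj he hle).fintype_card_le_finrank
  simp [hW] at this

theorem HasRoots.linearIndependent (hn : 2 ≤ n) (h : HasRoots Φ θ₁ θ₂ l) :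
    LinearIndependent ℂ ![θ₁, θ₂] := by
  have h2 : θ₂ ≠ 0 := by
    intro h0
    have h1 := h.degenerate ⟨0, by omega⟩
    obtain ⟨u, hu, -⟩ := isDegenerate_sub_smul_iff.1 h1
    exact h.nondegenerate ⟨u, hu, by simp [h0]⟩
  rw [linearIndependent_fin2]
  refine ⟨by simpa using h2, fun a ha => ?_⟩
  simp only [Matrix.cons_val_one, Matrix.cons_val_zero] at ha
  have key : ∀ k, l k = a := by
    intro k
    by_contra hne
    have h1 := h.degenerate k
    rw [← ha, ← sub_smul, isDegenerate_smul (sub_ne_zero.2 (Ne.symm hne))] at h1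
    exact h.nondegenerate h1
  have := h.injective ((key ⟨0, by omega⟩).trans (key ⟨1, by omega⟩).symm)
  simp at this

theorem smul_add_smul_eq {θ₁ θ₂ : QuadraticForm ℂ W} {a b : ℂ} (ha : a ≠ 0) :
    a • θ₁ + b • θ₂ = a • (θ₁ - (-b / a) • θ₂) := by
  rw [smul_sub, smul_smul, mul_div_cancel₀ _ ha, neg_smul, sub_neg_eq_add]

/-- The point of `ℙ Φ` given by the form `θ₁ - μ θ₂`. -/
noncomputable def pencilPoint (hli : LinearIndependent ℂ ![θ₁, θ₂])
    (hspan : Submodule.span ℂ {θ₁, θ₂} = Φ) (μ : ℂ) : ℙ ℂ Φ :=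
  Projectivization.mk ℂ ⟨θ₁ - μ • θ₂, hspan ▸ Submodule.mem_span_pair.2 ⟨1, -μ, by
    rw [one_smul, neg_smul, sub_eq_add_neg]⟩⟩ (by
      intro h0
      have h1 := (LinearIndependent.pair_iff.1 hli) 1 (-μ) (by
        rw [one_smul, neg_smul, ← sub_eq_add_neg]
        exact congrArg Subtype.val h0)
      exact one_ne_zero h1.1)

theorem pencilPoint_injective (hli : LinearIndependent ℂ ![θ₁, θ₂])
    (hspan : Submodule.span ℂ {θ₁, θ₂} = Φ) : Function.Injective (pencilPoint hli hspan) := by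
  intro μ ν h
  rw [pencilPoint, pencilPoint, Projectivization.mk_eq_mk_iff'] at h
  obtain ⟨a, ha⟩ := h
  have h1 : a • (θ₁ - ν • θ₂) = θ₁ - μ • θ₂ := congrArg Subtype.val ha
  have h2 := LinearIndependent.pair_iff.1 hli (a - 1) (μ - a * ν) (by
    rw [sub_smul, sub_smul, mul_smul, one_smul]
    rw [smul_sub] at h1
    linear_combination (norm := module) h1)
  have ha1 : a = 1 := sub_eq_zero.1 h2.1
  have := h2.2
  rw [ha1, one_mul, sub_eq_zero] at this
  exact this

theorem pencilPoint_mem_iff (hli : LinearIndependent ℂ ![θ₁, θ₂])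
    (hspan : Submodule.span ℂ {θ₁, θ₂} = Φ) (μ : ℂ) :
    pencilPoint hli hspan μ ∈ degeneratePoints Φ ↔ IsDegenerate (θ₁ - μ • θ₂) :=
  mk_mem_degeneratePoints _ _ _

/-- The only point of the projective line outside the affine chart `θ₁ - μ θ₂` is `θ₂`, which is
nondegenerate. -/
theorem exists_pencilPoint_eq (hli : LinearIndependent ℂ ![θ₁, θ₂])
    (hspan : Submodule.span ℂ {θ₁, θ₂} = Φ) (h2 : ¬ IsDegenerate θ₂) {p : ℙ ℂ Φ}
    (hp : p ∈ degeneratePoints Φ) : ∃ μ, pencilPoint hli hspan μ = p := by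
  induction p using Projectivization.ind with
  | h v hv =>
    rw [mk_mem_degeneratePoints] at hp
    obtain ⟨v, hvm⟩ := v
    obtain ⟨a, b, rfl⟩ := Submodule.mem_span_pair.1 (hspan ▸ hvm)
    have hab : a ≠ 0 := by
      rintro rfl
      have hb : b ≠ 0 := by
        rintro rfl
        exact hv (Subtype.ext (by simp))
      change IsDegenerate ((0 : ℂ) • θ₁ + b • θ₂) at hp
      rw [zero_smul, zero_add, isDegenerate_smul hb] at hp
      exact h2 hp
    refine ⟨-b / a, ?_⟩
    rw [pencilPoint, Projectivization.mk_eq_mk_iff']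
    refine ⟨a⁻¹, Subtype.ext ?_⟩
    change a⁻¹ • (a • θ₁ + b • θ₂) = _
    rw [smul_add_smul_eq hab, smul_smul, inv_mul_cancel₀ hab, one_smul]

theorem degeneratePoints_eq_range (hli : LinearIndependent ℂ ![θ₁, θ₂])
    (hspan : Submodule.span ℂ {θ₁, θ₂} = Φ) (h2 : ¬ IsDegenerate θ₂) :
    degeneratePoints Φ = pencilPoint hli hspan '' {μ | IsDegenerate (θ₁ - μ • θ₂)} := by
  ext p
  constructor
  · intro hp
    obtain ⟨μ, rfl⟩ := exists_pencilPoint_eq hli hspan h2 hp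
    exact ⟨μ, (pencilPoint_mem_iff hli hspan μ).1 hp, rfl⟩
  · rintro ⟨μ, hμ, rfl⟩
    exact (pencilPoint_mem_iff hli hspan μ).2 hμ

theorem HasRoots.setOf_eq_range [Module.Finite ℂ W] (hW : Module.finrank ℂ W = n)
    (h : HasRoots Φ θ₁ θ₂ l) : {μ | IsDegenerate (θ₁ - μ • θ₂)} = Set.range l := by
  ext μ
  exact ⟨fun hμ => h.exists_eq hW hμ, by rintro ⟨k, rfl⟩; exact h.degenerate k⟩

theorem HasRoots.isNonsingularPencil [Module.Finite ℂ W] (hn : 2 ≤ n)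
    (hW : Module.finrank ℂ W = n) (h : HasRoots Φ θ₁ θ₂ l) : IsNonsingularPencil Φ := by
  have hli := h.linearIndependent hn
  refine ⟨?_, ⟨θ₂, h.span_eq ▸ Submodule.subset_span (by simp), h.nondegenerate⟩, ?_⟩
  · have hr : Set.range ![θ₁, θ₂] = {θ₁, θ₂} := by simp [Set.pair_comm]
    rw [← h.span_eq, ← hr, finrank_span_eq_card hli, Fintype.card_fin]
  · rw [degeneratePoints_eq_range hli h.span_eq h.nondegenerate,
      Set.ncard_image_of_injective _ (pencilPoint_injective hli h.span_eq), h.setOf_eq_range hW,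
      ← Set.image_univ, Set.ncard_image_of_injective _ h.injective]
    simp [Set.ncard_univ, hW]

theorem linearIndependent_of_finrank_span (hspan : Submodule.span ℂ {θ₁, θ₂} = Φ)
    (hΦ : Module.finrank ℂ Φ = 2) : LinearIndependent ℂ ![θ₁, θ₂] := by
  rw [linearIndependent_iff_card_eq_finrank_span]
  have hr : Set.range ![θ₁, θ₂] = {θ₁, θ₂} := by simp [Set.pair_comm]
  rw [Set.finrank, hr, hspan, hΦ]
  rfl

theorem IsNonsingularPencil.exists_hasRoots (hn : 2 ≤ n)
    (hW : Module.finrank ℂ W = n) (hΦ : IsNonsingularPencil Φ)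
    (hspan : Submodule.span ℂ {θ₁, θ₂} = Φ) (h2 : ¬ IsDegenerate θ₂) :
    ∃ l : Fin n → ℂ, HasRoots Φ θ₁ θ₂ l := by
  have hli := linearIndependent_of_finrank_span hspan hΦ.finrank_eq
  have hc := hΦ.ncard_eq
  rw [degeneratePoints_eq_range hli hspan h2,
    Set.ncard_image_of_injective _ (pencilPoint_injective hli hspan), hW] at hc
  have hfin : {μ | IsDegenerate (θ₁ - μ • θ₂)}.Finite :=
    Set.finite_of_ncard_ne_zero (by rw [hc]; omega)
  have hcard : hfin.toFinset.card = n := by rw [← Set.ncard_eq_toFinset_card _ hfin, hc]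
  let E := (hfin.toFinset.equivFinOfCardEq hcard).symm
  refine ⟨fun k => E k, hspan, h2, fun i j hij => E.injective (Subtype.ext hij), fun k => ?_⟩
  exact hfin.mem_toFinset.1 (E k).2

theorem IsNonsingularPencil.exists_span (hΦ : IsNonsingularPencil Φ) :
    ∃ θ₁ θ₂ : QuadraticForm ℂ W, Submodule.span ℂ {θ₁, θ₂} = Φ ∧ ¬ IsDegenerate θ₂ := by
  obtain ⟨θ₂, hθ, hd⟩ := hΦ.nondegenerate
  have hfin : Module.Finite ℂ Φ := Module.finite_of_finrank_eq_succ hΦ.finrank_eq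
  -- The zero form is nondegenerate only on the zero space; there no form is degenerate, and any
  -- nonzero element of `Φ` serves instead.
  have h2 : (⟨θ₂, hθ⟩ : Φ) ≠ 0 ∨ ∀ θ : Φ, ¬ IsDegenerate (θ : QuadraticForm ℂ W) := by
    by_cases h : (⟨θ₂, hθ⟩ : Φ) = 0
    · right
      rintro θ ⟨u, hu, -⟩
      have h0 : θ₂ = 0 := congrArg Subtype.val h
      exact hd ⟨u, hu, by simp [h0]⟩
    · exact Or.inl h
  have key : ∀ θ : Φ, θ ≠ 0 → ∃ θ' : Φ, Submodule.span ℂ {θ', θ} = ⊤ := by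
    intro θ h0
    have hex : ∃ θ' : Φ, θ' ∉ Submodule.span ℂ {θ} := by
      by_contra hall
      push Not at hall
      have htop : Submodule.span ℂ {θ} = ⊤ := by
        rw [eq_top_iff]
        exact fun x _ => hall x
      have h1 := finrank_span_singleton (K := ℂ) h0
      rw [htop, finrank_top, hΦ.finrank_eq] at h1
      omega
    obtain ⟨θ', h'⟩ := hex
    have hli : LinearIndependent ℂ ![θ', θ] := by
      rw [linearIndependent_fin2]
      refine ⟨h0, fun a ha => h' ?_⟩
      exact Submodule.mem_span_singleton.2 ⟨a, ha⟩
    refine ⟨θ', ?_⟩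
    have := hli.span_eq_top_of_card_eq_finrank (by simp [hΦ.finrank_eq])
    simpa [Set.pair_comm] using this
  have conc : ∀ θ : Φ, θ ≠ 0 → ¬ IsDegenerate (θ : QuadraticForm ℂ W) →
      ∃ θ₁ θ₂ : QuadraticForm ℂ W, Submodule.span ℂ {θ₁, θ₂} = Φ ∧ ¬ IsDegenerate θ₂ := by
    intro θ h0 hθd
    obtain ⟨θ', h'⟩ := key θ h0
    refine ⟨θ', θ, ?_, hθd⟩
    have := congrArg (Submodule.map Φ.subtype) h'
    rw [Submodule.map_span, Set.image_pair, Submodule.map_top, Submodule.range_subtype] at this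
    exact this
  rcases h2 with h2 | h2
  · exact conc _ h2 hd
  · have : Nontrivial Φ := Module.nontrivial_of_finrank_pos (R := ℂ) (by rw [hΦ.finrank_eq]; omega)
    obtain ⟨θ, hθ⟩ := exists_ne (0 : Φ)
    exact conc θ hθ (h2 θ)

theorem HasRoots.pullback {W' : Type*} [AddCommGroup W'] [Module ℂ W'] (e : W' ≃ₗ[ℂ] W)
    (h : HasRoots Φ θ₁ θ₂ l) :
    HasRoots (pullbackPencil e Φ) (pullbackForm e θ₁) (pullbackForm e θ₂) l := by
  refine ⟨?_, by rw [isDegenerate_pullbackForm]; exact h.nondegenerate, h.injective, fun k => ?_⟩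
  · rw [pullbackPencil, ← h.span_eq, Submodule.map_span, Set.image_pair]
    rfl
  · rw [← map_smul, ← map_sub, isDegenerate_pullbackForm]
    exact h.degenerate k

/-- The finite sequences `l` and `m` correspond to each other by a projective transformation,
up to their order. -/
def MoebiusRelated {n : ℕ} (l m : Fin n → ℂ) : Prop :=
  ∃ a b c d : ℂ, a * d - b * c ≠ 0 ∧ ∃ σ : Equiv.Perm (Fin n),
    ∀ k, m k * (c * l (σ k) + d) = a * l (σ k) + b

/-- Two bases of the pencil differ by an invertible matrix. If `θ₁' = x θ₁ + y θ₂` and `θ₂' = z θ₁ +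
w θ₂`, then `θ₁' - m θ₂' = (x - m z) θ₁ + (y - m w) θ₂`, so that a root `m` comes from the root `l`
with `m (z l + w) = x l + y`. -/
theorem HasRoots.moebiusRelated [Module.Finite ℂ W] (hn : 2 ≤ n)
    (hW : Module.finrank ℂ W = n) {θ₁' θ₂' : QuadraticForm ℂ W} {m : Fin n → ℂ}
    (h : HasRoots Φ θ₁ θ₂ l) (h' : HasRoots Φ θ₁' θ₂' m) : MoebiusRelated l m := by
  have hli := h.linearIndependent hn
  have hli' := h'.linearIndependent hn
  have mem : ∀ {θ}, θ ∈ ({θ₁', θ₂'} : Set (QuadraticForm ℂ W)) →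
      ∃ x y : ℂ, x • θ₁ + y • θ₂ = θ := fun hθ => Submodule.mem_span_pair.1
    (h.span_eq ▸ h'.span_eq ▸ Submodule.subset_span hθ)
  obtain ⟨x, y, h1⟩ := mem (θ := θ₁') (by simp)
  obtain ⟨z, w, h2⟩ := mem (θ := θ₂') (by simp)
  have hdet : x * w - y * z ≠ 0 := by
    intro h0
    have e1 : w • θ₁' + (-y) • θ₂' = 0 := by
      rw [← h1, ← h2]
      linear_combination (norm := module) h0 • θ₁
    have e2 : z • θ₁' + (-x) • θ₂' = 0 := by
      rw [← h1, ← h2]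
      linear_combination (norm := module) (-h0) • θ₂
    obtain ⟨rfl, hy⟩ := LinearIndependent.pair_iff.1 hli' _ _ e1
    obtain ⟨rfl, hx⟩ := LinearIndependent.pair_iff.1 hli' _ _ e2
    have hx : x = 0 := neg_eq_zero.1 hx
    have hy : y = 0 := neg_eq_zero.1 hy
    refine h'.nondegenerate ?_
    obtain ⟨u, hu, -⟩ := h.degenerate ⟨0, by omega⟩
    exact ⟨u, hu, by simp [← h2]⟩
  have key : ∀ k, ∃ j, l j * (x - m k * z) = -(y - m k * w) := by
    intro k
    have hd := h'.degenerate k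
    have he : θ₁' - m k • θ₂' = (x - m k * z) • θ₁ + (y - m k * w) • θ₂ := by
      rw [← h1, ← h2]; module
    rw [he] at hd
    -- Otherwise a nonzero multiple of `θ₂` would be degenerate.
    have hne : x - m k * z ≠ 0 := by
      intro h0
      have hne : y - m k * w ≠ 0 := by
        intro h0'
        apply hdet
        linear_combination w * h0 - z * h0'
      rw [h0, zero_smul, zero_add, isDegenerate_smul hne] at hd
      exact h.nondegenerate hd
    rw [smul_add_smul_eq hne, isDegenerate_smul hne] at hd
    obtain ⟨j, hj⟩ := h.exists_eq hW hd
    exact ⟨j, by rw [hj]; field_simp⟩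
  choose σ hσ using key
  have hinj : Function.Injective σ := by
    intro i j hij
    apply h'.injective
    have h1 := hσ i
    have h2 := hσ j
    rw [hij] at h1
    have h3 : (m i - m j) * (l (σ j) * z + w) = 0 := by linear_combination h2 - h1
    rcases mul_eq_zero.1 h3 with h3 | h3
    · exact sub_eq_zero.1 h3
    · exfalso
      have h4 : l (σ j) * x + y = 0 := by linear_combination h2 + m j * h3
      refine hdet ?_
      by_cases hz : z = 0
      · subst hz
        have : w = 0 := by simpa using h3
        simp [this]
      · linear_combination x * h3 - z * h4
  refine ⟨x, y, z, w, hdet, Equiv.ofBijective σ (Finite.injective_iff_bijective.1 hinj),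
    fun k => ?_⟩
  have := hσ k
  simp only [Equiv.ofBijective_apply]
  linear_combination -this

end Roots

/-! ### Changes of basis of a plane. -/

section LinearAlgebra

theorem det_ne_zero_of_linearIndependent {M : Type*} [AddCommGroup M] [Module ℂ M] {u v : M}
    {a b c d : ℂ} (h : LinearIndependent ℂ ![a • u + b • v, c • u + d • v]) :
    a * d - b * c ≠ 0 := by
  intro h0
  obtain ⟨rfl, hb⟩ := LinearIndependent.pair_iff.1 h d (-b) (by
    linear_combination (norm := module) h0 • u)
  obtain ⟨rfl, ha⟩ := LinearIndependent.pair_iff.1 h c (-a) (by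
    linear_combination (norm := module) (-h0) • v)
  have := (LinearIndependent.pair_iff.1 h 0 1 (by simp)).2
  exact one_ne_zero this

theorem span_pair_eq_of_det_ne_zero {M : Type*} [AddCommGroup M] [Module ℂ M] (u v : M)
    {a b c d : ℂ} (h : a * d - b * c ≠ 0) :
    Submodule.span ℂ {a • u + b • v, c • u + d • v} = Submodule.span ℂ {u, v} := by
  apply le_antisymm
  · rw [Submodule.span_le, Set.pair_subset_iff]
    exact ⟨Submodule.mem_span_pair.2 ⟨a, b, rfl⟩, Submodule.mem_span_pair.2 ⟨c, d, rfl⟩⟩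
  · rw [Submodule.span_le, Set.pair_subset_iff]
    constructor
    · refine Submodule.mem_span_pair.2 ⟨(a * d - b * c)⁻¹ * d, -((a * d - b * c)⁻¹ * b), ?_⟩
      match_scalars <;> field_simp <;> ring
    · refine Submodule.mem_span_pair.2 ⟨-((a * d - b * c)⁻¹ * c), (a * d - b * c)⁻¹ * a, ?_⟩
      match_scalars <;> field_simp <;> ring

end LinearAlgebra

/-! ### Simple roots and the implicit function theorem. -/

section Implicit

theorem exists_implicit_root {E : Type*} [NormedAddCommGroup E] [NormedSpace ℂ E]
    [CompleteSpace E] {p : E × ℂ → ℂ} {e₀ : E} {z₀ d : ℂ} (hp : ContDiffAt ℂ 1 p (e₀, z₀))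
    (h0 : p (e₀, z₀) = 0) (hd : HasDerivAt (fun z => p (e₀, z)) d z₀) (hd0 : d ≠ 0) :
    ∃ r : E → ℂ, r e₀ = z₀ ∧ (∀ᶠ e in 𝓝 e₀, p (e, r e) = 0) ∧ DifferentiableAt ℂ r e₀ := by
  have h1 : HasFDerivAt p (fderiv ℂ p (e₀, z₀)) (e₀, z₀) :=
    (hp.differentiableAt one_ne_zero).hasFDerivAt
  have h2 : HasDerivAt (fun z => p (e₀, z)) (fderiv ℂ p (e₀, z₀) (0, 1)) z₀ :=
    h1.comp_hasDerivAt z₀ ((hasDerivAt_const z₀ e₀).prodMk (hasDerivAt_id z₀))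
  have hd' : fderiv ℂ p (e₀, z₀) (0, 1) = d := h2.unique hd
  have hinv : (fderiv ℂ p (e₀, z₀) ∘L .inr ℂ E ℂ).IsInvertible := by
    refine ⟨ContinuousLinearEquiv.unitsEquivAut ℂ (Units.mk0 d hd0), ?_⟩
    ext
    simp [hd']
  exact ⟨hp.implicitFunction one_ne_zero hinv, hp.implicitFunction_apply_self one_ne_zero hinv,
    (hp.eventually_apply_implicitFunction one_ne_zero hinv).mono fun e he => he.trans h0,
    (hp.hasStrictFDerivAt_implicitFunction one_ne_zero hinv).hasFDerivAt.differentiableAt⟩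

/-- A polynomial of degree at most `n` with `n` distinct roots has no room for a multiple one. -/
theorem derivative_eval_ne_zero_of_injective_roots {n : ℕ} {P : Polynomial ℂ} (hP : P ≠ 0)
    (hdeg : P.natDegree ≤ n) {l : Fin n → ℂ} (hl : Function.Injective l)
    (hroot : ∀ k, P.eval (l k) = 0) (k : Fin n) : P.derivative.eval (l k) ≠ 0 := by
  classical
  have hsub : Finset.univ.image l ⊆ P.roots.toFinset := by
    intro z hz
    obtain ⟨j, -, rfl⟩ := Finset.mem_image.1 hz
    simpa [hP] using hroot j
  have h1 : n ≤ P.roots.toFinset.card := by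
    calc n = (Finset.univ.image l).card := by simp [Finset.card_image_of_injective _ hl]
      _ ≤ _ := Finset.card_le_card hsub
  have h2 := P.roots.toFinset_card_le
  have h3 := P.card_roots'
  have hnodup : P.roots.Nodup := Multiset.toFinset_card_eq_card_iff_nodup.1 (by omega)
  have hle := Multiset.nodup_iff_count_le_one.1 hnodup (l k)
  rw [Polynomial.count_roots] at hle
  intro h0
  have := (Polynomial.one_lt_rootMultiplicity_iff_isRoot hP).2 ⟨hroot k, h0⟩
  omega

end Implicit

/-! ### Pencils given by coefficient arrays; diagonal pencils. -/

section Coefficients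

variable {n : ℕ}

theorem associated_eq {W : Type*} [AddCommGroup W] [Module ℂ W] (φ : QuadraticForm ℂ W)
    (u v : W) : QuadraticMap.associated φ u v = 2⁻¹ * (φ (u + v) - φ u - φ v) := by
  have h : (2 : ℕ) • QuadraticMap.associated φ u v = φ (u + v) - φ u - φ v :=
    LinearMap.congr_fun₂ (QuadraticMap.two_nsmul_associated ℂ φ) u v
  rw [← h, nsmul_eq_mul]
  push_cast
  ring

theorem toQuadraticForm'_apply (M : Matrix (Fin n) (Fin n) ℂ) (z : Fin n → ℂ) :
    M.toQuadraticForm' z = z ⬝ᵥ M.mulVec z :=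
  Matrix.toLinearMap₂'_apply' M z z

/-- The array `M` need not be symmetric: the Gram matrix of its form is half of `M + Mᵀ`. -/
theorem isDegenerate_toQuadraticForm' (M : Matrix (Fin n) (Fin n) ℂ) :
    IsDegenerate M.toQuadraticForm' ↔ (M + M.transpose).det = 0 := by
  have key : ∀ u v : Fin n → ℂ, QuadraticMap.associated M.toQuadraticForm' u v =
      2⁻¹ * (Matrix.vecMul u (M + M.transpose) ⬝ᵥ v) := by
    intro u v
    rw [associated_eq, toQuadraticForm'_apply, toQuadraticForm'_apply, toQuadraticForm'_apply]
    have h1 : v ⬝ᵥ M.mulVec u = u ⬝ᵥ M.transpose.mulVec v := by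
      rw [Matrix.mulVec_transpose, Matrix.dotProduct_mulVec, dotProduct_comm]
    rw [← Matrix.dotProduct_mulVec, Matrix.add_mulVec, dotProduct_add, ← h1, Matrix.mulVec_add,
      add_dotProduct, dotProduct_add, dotProduct_add]
    ring
  rw [← Matrix.exists_vecMul_eq_zero_iff, IsDegenerate]
  refine exists_congr fun u => and_congr_right fun _ => ?_
  simp only [key]
  constructor
  · intro h
    rw [← dotProduct_eq_zero_iff]
    intro v
    simpa using h v
  · intro h v
    rw [h]; simp

theorem toQuadraticForm'_smul_add_smul (a b : ℂ) (M N : Matrix (Fin n) (Fin n) ℂ) :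
    (a • M + b • N).toQuadraticForm' = a • M.toQuadraticForm' + b • N.toQuadraticForm' := by
  ext z
  simp [toQuadraticForm'_apply, Matrix.add_mulVec, Matrix.smul_mulVec]

/-- The diagonal array with entries `w`. -/
def diagonalArray (w : Fin n → ℂ) : Fin n → Fin n → ℂ := fun i j => if i = j then w i else 0

/-- The pair of the forms `∑ lᵢ zᵢ²` and `∑ zᵢ²`. -/
def diagonalPair (l : Fin n → ℂ) : (Fin n → Fin n → ℂ) × (Fin n → Fin n → ℂ) :=
  (diagonalArray l, diagonalArray 1)

theorem diagonal_toQuadraticForm'_apply (w z : Fin n → ℂ) :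
    (Matrix.diagonal w).toQuadraticForm' z = ∑ i, w i * z i ^ 2 := by
  rw [toQuadraticForm'_apply, dotProduct]
  refine Finset.sum_congr rfl fun i _ => ?_
  rw [Matrix.mulVec_diagonal]
  ring

theorem hasRoots_diagonalPair {l : Fin n → ℂ} (hl : Function.Injective l) :
    HasRoots (coefficientPencil (diagonalPair l)) (Matrix.diagonal l).toQuadraticForm'
      (Matrix.diagonal 1).toQuadraticForm' l where
  span_eq := rfl
  nondegenerate := by
    rw [isDegenerate_toQuadraticForm', Matrix.diagonal_transpose, Matrix.diagonal_add,
      Matrix.det_diagonal]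
    simp
  injective := hl
  degenerate k := by
    have h := toQuadraticForm'_smul_add_smul 1 (-l k) (Matrix.diagonal l) (Matrix.diagonal 1)
    rw [one_smul, one_smul, neg_smul (M := QuadraticForm ℂ (Fin n → ℂ)), ← sub_eq_add_neg] at h
    rw [← h, isDegenerate_toQuadraticForm', ← Matrix.diagonal_smul,
      Matrix.diagonal_add, Matrix.diagonal_transpose, Matrix.diagonal_add, Matrix.det_diagonal]
    exact Finset.prod_eq_zero (Finset.mem_univ k) (by simp)

theorem isNonsingularPencil_diagonalPair (hn : 2 ≤ n) {l : Fin n → ℂ}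
    (hl : Function.Injective l) : IsNonsingularPencil (coefficientPencil (diagonalPair l)) :=
  (hasRoots_diagonalPair hl).isNonsingularPencil hn (by simp)

/-- The class of the pencil generated by `∑ lᵢ zᵢ²` and `∑ zᵢ²`. -/
noncomputable def diagonalClass (hn : 2 ≤ n) {l : Fin n → ℂ} (hl : Function.Injective l) :
    ModuliPQ n :=
  Quotient.mk (pencilSetoid n) ⟨_, isNonsingularPencil_diagonalPair hn hl⟩

theorem coefficientPullback_diagonalPair (hn : 2 ≤ n) {l : Fin n → ℂ}
    (hl : Function.Injective l) (f : ModuliPQ n → ℂ) :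
    coefficientPullback f (diagonalPair l) = f (diagonalClass hn hl) :=
  dif_pos (isNonsingularPencil_diagonalPair hn hl)

theorem pullbackPencil_eq_coefficientPencil {W : Type*} [AddCommGroup W] [Module ℂ W]
    {q₁ q₂ : QuadraticForm ℂ W} (e : (Fin n → ℂ) ≃ₗ[ℂ] W) {l : Fin n → ℂ}
    (h1 : ∀ z, q₁ (e z) = ∑ i, l i * z i ^ 2) (h2 : ∀ z, q₂ (e z) = ∑ i, z i ^ 2) :
    pullbackPencil e (Submodule.span ℂ {q₁, q₂}) = coefficientPencil (diagonalPair l) := by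
  have e1 : pullbackForm e q₁ = (Matrix.diagonal l).toQuadraticForm' := by
    ext z; rw [pullbackForm_apply, h1, diagonal_toQuadraticForm'_apply]
  have e2 : pullbackForm e q₂ = (Matrix.diagonal 1).toQuadraticForm' := by
    ext z; rw [pullbackForm_apply, h2, diagonal_toQuadraticForm'_apply]; simp
  rw [pullbackPencil, Submodule.map_span, Set.image_pair]
  exact congrArg₂ (fun a b => Submodule.span ℂ {a, b}) e1 e2

/-- Rescaling the `k`-th coordinate by a square root of `(c l k + d)⁻¹` turns the basis `a θ₁ + b
θ₂`, `c θ₁ + d θ₂` of the pencil of `l` into the diagonal pair of `m`. -/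
theorem diagonalClass_moebius (hn : 2 ≤ n) {l m : Fin n → ℂ} (hl : Function.Injective l)
    (hm : Function.Injective m) {a b c d : ℂ} (hdet : a * d - b * c ≠ 0)
    (hden : ∀ k, c * l k + d ≠ 0) (h : ∀ k, m k * (c * l k + d) = a * l k + b) :
    diagonalClass hn hm = diagonalClass hn hl := by
  have hsq : ∀ k, ∃ t : ℂ, (c * l k + d)⁻¹ = t ^ 2 := fun k =>
    ⟨_, (Complex.cpow_nat_inv_pow _ two_ne_zero).symm⟩
  choose t ht using hsq
  have ht0 : ∀ k, t k ≠ 0 := fun k h0 => hden k (by simpa [h0] using ht k)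
  let T : (Fin n → ℂ) ≃ₗ[ℂ] (Fin n → ℂ) :=
    LinearEquiv.piCongrRight fun k => LinearEquiv.smulOfNeZero ℂ ℂ (t k) (ht0 k)
  have hT : ∀ z k, T z k = t k * z k := fun _ _ => rfl
  symm
  refine Quotient.sound ⟨T, ?_⟩
  have hpair := span_pair_eq_of_det_ne_zero (Matrix.diagonal l).toQuadraticForm'
    (Matrix.diagonal (1 : Fin n → ℂ)).toQuadraticForm' hdet
  refine Eq.trans (pullbackPencil_eq_coefficientPencil T (l := m) ?_ ?_).symm
    (congrArg (pullbackPencil T) hpair)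
  · intro z
    simp only [_root_.add_apply, _root_.smul_apply, diagonal_toQuadraticForm'_apply,
      hT, smul_eq_mul, Finset.mul_sum, ← Finset.sum_add_distrib]
    refine Finset.sum_congr rfl fun k _ => ?_
    rw [mul_pow, ← ht, Pi.one_apply]
    rw [show m k = (a * l k + b) * (c * l k + d)⁻¹ from
      (eq_mul_inv_iff_mul_eq₀ (hden k)).2 (h k)]
    ring
  · intro z
    simp only [_root_.add_apply, _root_.smul_apply, diagonal_toQuadraticForm'_apply,
      hT, smul_eq_mul, Finset.mul_sum, ← Finset.sum_add_distrib]
    refine Finset.sum_congr rfl fun k _ => ?_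
    rw [mul_pow, ← ht, Pi.one_apply]
    field_simp [hden k]

end Coefficients

/-! ### Holomorphic functions on the moduli space. -/

section Holomorphy

variable {n : ℕ}

/-- Twice the symmetric matrix of the quadratic form with the coefficients `M`. -/
def symmetrization (M : Fin n → Fin n → ℂ) : Matrix (Fin n) (Fin n) ℂ :=
  Matrix.of fun i j => M i j + M j i

theorem isDegenerate_of_iff (M : Fin n → Fin n → ℂ) :
    IsDegenerate (Matrix.of M).toQuadraticForm' ↔ (symmetrization M).det = 0 :=
  isDegenerate_toQuadraticForm' _

theorem contDiff_det_symmetrization {E : Type*} [NormedAddCommGroup E] [NormedSpace ℂ E]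
    {g : E → Fin n → Fin n → ℂ} (hg : ContDiff ℂ 1 g) :
    ContDiff ℂ 1 fun e => (symmetrization (g e)).det := by
  have hij : ∀ i j, ContDiff ℂ 1 fun e => g e i j := fun i j =>
    contDiff_pi.1 (contDiff_pi.1 hg i) j
  simp only [Matrix.det_apply']
  refine ContDiff.sum fun σ _ => contDiff_const.mul (contDiff_prod fun i _ => ?_)
  exact (hij _ _).add (hij _ _)

/-- The roots of a nonsingular pencil depend holomorphically on its coefficients. -/
theorem exists_differentiableAt_roots (hn : 2 ≤ n)
    {AB : (Fin n → Fin n → ℂ) × (Fin n → Fin n → ℂ)}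
    (h : IsNonsingularPencil (coefficientPencil AB)) :
    ∃ r : (Fin n → Fin n → ℂ) × (Fin n → Fin n → ℂ) → Fin n → ℂ,
      DifferentiableAt ℂ r AB ∧
      ∀ᶠ CD in 𝓝 AB, ∃ θ₁ θ₂, HasRoots (coefficientPencil CD) θ₁ θ₂ (r CD) := by
  obtain ⟨θ₁, θ₂, hspan, h2⟩ := h.exists_span
  obtain ⟨l, hl⟩ := h.exists_hasRoots hn (by simp) hspan h2
  have mem : ∀ {θ}, θ ∈ ({θ₁, θ₂} : Set (QuadraticForm ℂ (Fin n → ℂ))) →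
      ∃ x y : ℂ, x • (Matrix.of AB.1).toQuadraticForm' + y • (Matrix.of AB.2).toQuadraticForm' =
        θ := fun hθ => Submodule.mem_span_pair.1 (by
    have := Submodule.subset_span (R := ℂ) hθ
    rwa [hspan] at this)
  obtain ⟨a, b, h1⟩ := mem (θ := θ₁) (by simp)
  obtain ⟨c, d, h2'⟩ := mem (θ := θ₂) (by simp)
  have hdet : a * d - b * c ≠ 0 := by
    refine det_ne_zero_of_linearIndependent (u := (Matrix.of AB.1).toQuadraticForm')
      (v := (Matrix.of AB.2).toQuadraticForm') ?_
    rw [h1, h2']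
    exact hl.linearIndependent hn
  -- The change of basis which makes the second generator nondegenerate at `AB` is kept constant
  -- near `AB`.
  let T₁ : (Fin n → Fin n → ℂ) × (Fin n → Fin n → ℂ) → Fin n → Fin n → ℂ := fun CD =>
    a • CD.1 + b • CD.2
  let T₂ : (Fin n → Fin n → ℂ) × (Fin n → Fin n → ℂ) → Fin n → Fin n → ℂ := fun CD =>
    c • CD.1 + d • CD.2
  have hT₁ : ∀ CD, (Matrix.of (T₁ CD)).toQuadraticForm' =
      a • (Matrix.of CD.1).toQuadraticForm' + b • (Matrix.of CD.2).toQuadraticForm' := fun CD =>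
    toQuadraticForm'_smul_add_smul a b _ _
  have hT₂ : ∀ CD, (Matrix.of (T₂ CD)).toQuadraticForm' =
      c • (Matrix.of CD.1).toQuadraticForm' + d • (Matrix.of CD.2).toQuadraticForm' := fun CD =>
    toQuadraticForm'_smul_add_smul c d _ _
  have hsub : ∀ CD (μ : ℂ), (Matrix.of (T₁ CD - μ • T₂ CD)).toQuadraticForm' =
      (Matrix.of (T₁ CD)).toQuadraticForm' - μ • (Matrix.of (T₂ CD)).toQuadraticForm' := by
    intro CD μ
    have := toQuadraticForm'_smul_add_smul 1 (-μ) (Matrix.of (T₁ CD)) (Matrix.of (T₂ CD))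
    rw [one_smul, one_smul, neg_smul (M := QuadraticForm ℂ (Fin n → ℂ)), ← sub_eq_add_neg,
      neg_smul, ← sub_eq_add_neg] at this
    exact this
  let p : ((Fin n → Fin n → ℂ) × (Fin n → Fin n → ℂ)) × ℂ → ℂ := fun x =>
    (symmetrization (T₁ x.1 - x.2 • T₂ x.1)).det
  have hp : ContDiff ℂ 1 p := contDiff_det_symmetrization (by
    simp only [T₁, T₂]
    fun_prop)
  have hp0 : ∀ CD μ, p (CD, μ) = 0 ↔ IsDegenerate ((Matrix.of (T₁ CD)).toQuadraticForm' -
      μ • (Matrix.of (T₂ CD)).toQuadraticForm') := by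
    intro CD μ
    rw [← hsub, isDegenerate_of_iff]
  -- The discriminant at the fixed point `AB` as a polynomial in `μ`. It has degree at most `n` and
  -- `n` distinct roots, so they are simple and continue holomorphically.
  let P : Polynomial ℂ := Matrix.det ((Polynomial.X : Polynomial ℂ) •
    (-symmetrization (T₂ AB)).map Polynomial.C + (symmetrization (T₁ AB)).map Polynomial.C)
  have hPp : ∀ μ, P.eval μ = p (AB, μ) := by
    intro μ
    rw [← Polynomial.coe_evalRingHom]
    simp only [P, p]
    rw [RingHom.map_det]
    congr 1
    ext i j
    simp [symmetrization]
    ring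
  have hdet2 : (symmetrization (T₂ AB)).det ≠ 0 := by
    rw [Ne, ← isDegenerate_of_iff, hT₂, h2']
    exact h2
  have hP0 : P ≠ 0 := by
    intro h0
    -- The coefficient of degree `n` is, up to sign, the determinant of the nondegenerate second
    -- form.
    have := Polynomial.coeff_det_X_add_C_card (-symmetrization (T₂ AB)) (symmetrization (T₁ AB))
    rw [show Matrix.det _ = P from rfl, h0, Polynomial.coeff_zero, Matrix.det_neg] at this
    rcases mul_eq_zero.1 this.symm with h' | h'
    · exact absurd h' (pow_ne_zero _ (by norm_num))
    · exact hdet2 h'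
  have hPdeg : P.natDegree ≤ n := by
    simpa using Polynomial.natDegree_det_X_add_C_le (-symmetrization (T₂ AB))
      (symmetrization (T₁ AB))
  have hroot : ∀ k, p (AB, l k) = 0 := by
    intro k
    rw [hp0, hT₁, hT₂, h1, h2']
    exact hl.degenerate k
  have hex : ∀ k, ∃ r : (Fin n → Fin n → ℂ) × (Fin n → Fin n → ℂ) → ℂ, r AB = l k ∧
      (∀ᶠ CD in 𝓝 AB, p (CD, r CD) = 0) ∧ DifferentiableAt ℂ r AB := by
    intro k
    refine exists_implicit_root (d := P.derivative.eval (l k)) hp.contDiffAt (hroot k) ?_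
      (derivative_eval_ne_zero_of_injective_roots hP0 hPdeg hl.injective
        (fun k => (hPp _).trans (hroot k)) k)
    simp only [← hPp]
    exact P.hasDerivAt (l k)
  choose r hr0 hrp hrd using hex
  refine ⟨fun CD k => r k CD, differentiableAt_pi.2 hrd, ?_⟩
  have hinj : ∀ᶠ CD in 𝓝 AB, Function.Injective fun k => r k CD := by
    have hne : ∀ i j, i ≠ j → ∀ᶠ CD in 𝓝 AB, r i CD ≠ r j CD := by
      intro i j hij
      refine ((hrd i).continuousAt.sub (hrd j).continuousAt).eventually_ne ?_ |>.mono
        fun CD h => sub_ne_zero.1 h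
      rw [Pi.sub_apply, hr0, hr0]
      exact sub_ne_zero.2 (hl.injective.ne hij)
    have : ∀ᶠ CD in 𝓝 AB, ∀ i j, i ≠ j → r i CD ≠ r j CD := by
      simp only [eventually_all]
      exact hne
    filter_upwards [this] with CD h i j hij
    by_contra hne'
    exact h i j hne' hij
  have hnd : ∀ᶠ CD in 𝓝 AB, (symmetrization (T₂ CD)).det ≠ 0 := by
    have hc : ContDiff ℂ 1 fun CD => (symmetrization (T₂ CD)).det :=
      contDiff_det_symmetrization (by
        simp only [T₂]
        fun_prop)
    exact hc.continuous.continuousAt.eventually_ne hdet2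
  filter_upwards [hinj, hnd, eventually_all.2 hrp] with CD hCD1 hCD2 hCD3
  refine ⟨(Matrix.of (T₁ CD)).toQuadraticForm', (Matrix.of (T₂ CD)).toQuadraticForm', ?_, ?_,
    hCD1, fun k => (hp0 _ _).1 (hCD3 k)⟩
  · rw [hT₁, hT₂]
    exact span_pair_eq_of_det_ne_zero _ _ hdet
  · rwa [isDegenerate_of_iff]

/-- A function of `n` distinct complex numbers which is invariant under projective
transformations and permutations gives a holomorphic function on the moduli space. -/
theorem exists_holomorphic_of_moebius_invariant (hn : 2 ≤ n) (F : (Fin n → ℂ) → ℂ)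
    (hF : ∀ l m, Function.Injective l → Function.Injective m → MoebiusRelated l m → F l = F m)
    (hd : ∀ l, Function.Injective l → DifferentiableAt ℂ F l) :
    ∃ f : ModuliPQ n → ℂ, (∀ m, IsHolomorphicNear f m) ∧
      ∀ l (hl : Function.Injective l), f (diagonalClass hn hl) = F l := by
  have hex : ∀ Φ : {Φ : Submodule ℂ (QuadraticForm ℂ (Fin n → ℂ)) // IsNonsingularPencil Φ},
      ∃ θ₁ θ₂, ∃ l : Fin n → ℂ, HasRoots Φ.1 θ₁ θ₂ l := by
    intro Φ
    obtain ⟨θ₁, θ₂, hspan, h2⟩ := Φ.2.exists_span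
    exact ⟨θ₁, θ₂, Φ.2.exists_hasRoots hn (by simp) hspan h2⟩
  choose t₁ t₂ L hL using hex
  have hLF : ∀ Φ θ₁ θ₂ l, HasRoots Φ.1 θ₁ θ₂ l → F (L Φ) = F l := fun Φ θ₁ θ₂ l h =>
    hF _ _ (hL Φ).injective h.injective ((hL Φ).moebiusRelated hn (by simp) h)
  -- Roots are chosen for each pencil without any continuity; invariance of `F` makes the value
  -- independent of the choice and of the representative of the class.
  let f : ModuliPQ n → ℂ := Quotient.lift (fun Φ => F (L Φ)) (by
    rintro Φ Ψ ⟨T, hT⟩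
    symm
    refine hLF Ψ (pullbackForm T (t₁ Φ)) (pullbackForm T (t₂ Φ)) _ ?_
    rw [hT]
    exact (hL Φ).pullback T)
  have hfF : ∀ Φ θ₁ θ₂ l, HasRoots Φ.1 θ₁ θ₂ l → f (Quotient.mk _ Φ) = F l := hLF
  refine ⟨f, fun m => ⟨Set.univ, Set.mem_univ _, ?_, ?_⟩, fun l hl =>
    hfF ⟨_, _⟩ _ _ _ (hasRoots_diagonalPair hl)⟩
  · rw [isOpen_iff_mem_nhds]
    rintro AB ⟨h, -⟩
    obtain ⟨r, -, hr⟩ := exists_differentiableAt_roots hn h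
    filter_upwards [hr] with CD hCD
    obtain ⟨θ₁, θ₂, hCD⟩ := hCD
    exact ⟨hCD.isNonsingularPencil hn (by simp), Set.mem_univ _⟩
  · rintro AB ⟨h, -⟩
    obtain ⟨r, hrd, hr⟩ := exists_differentiableAt_roots hn h
    obtain ⟨θ₁, θ₂, hAB⟩ := hr.self_of_nhds
    -- Near `AB` the arbitrary choice of roots may be replaced by the holomorphic one.
    have heq : coefficientPullback f =ᶠ[𝓝 AB] fun CD => F (r CD) := by
      filter_upwards [hr] with CD hCD
      obtain ⟨θ₁, θ₂, hCD⟩ := hCD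
      rw [coefficientPullback, dif_pos (hCD.isNonsingularPencil hn (by simp))]
      exact hfF ⟨_, _⟩ _ _ _ hCD
    have : DifferentiableAt ℂ (fun CD => F (r CD)) AB := (hd _ hAB.injective).comp AB hrd
    exact (this.congr_of_eventuallyEq heq).differentiableWithinAt

/-- The differential of a holomorphic function on the moduli space, in terms of the roots of the
discriminant, vanishes on the tangent vectors of the orbits of the projective group. -/
theorem fderiv_coefficientPullback_diagonalPair (hn : 2 ≤ n) {f : ModuliPQ n → ℂ}
    {l : Fin n → ℂ} (hl : Function.Injective l)
    (hf : IsHolomorphicNear f (diagonalClass hn hl)) :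
    ∃ G' : (Fin n → ℂ) →L[ℂ] ℂ,
      HasFDerivAt (fun m => coefficientPullback f (diagonalPair m)) G' l ∧
      ∀ a b c : ℂ, G' (fun k => a + b * l k + c * l k ^ 2) = 0 := by
  obtain ⟨U, hU, hopen, hdiff⟩ := hf
  have hmem : diagonalPair l ∈ coefficientPreimage U := ⟨_, hU⟩
  have hd : DifferentiableAt ℂ (coefficientPullback f) (diagonalPair l) :=
    hdiff.differentiableAt (hopen.mem_nhds hmem)
  have hpair : Differentiable ℂ (diagonalPair : (Fin n → ℂ) → _) := by
    refine Differentiable.prodMk ?_ (differentiable_const _)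
    refine differentiable_pi.2 fun i => differentiable_pi.2 fun j => ?_
    simp only [diagonalArray]
    split_ifs
    · exact differentiable_apply i
    · exact differentiable_const _
  have hG : DifferentiableAt ℂ (fun m => coefficientPullback f (diagonalPair m)) l :=
    hd.comp l hpair.differentiableAt
  refine ⟨_, hG.hasFDerivAt, fun a b c => ?_⟩
  -- A curve in the projective orbit of `l`, given by the matrices with rows `(1 + s b, s a)` and
  -- `(-s c, 1)`; its velocity at `s = 0` is `a + b l + c l²`.
  let g : ℂ → Fin n → ℂ := fun s k => (l k + s * (a + b * l k)) / (1 - s * (c * l k))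
  have hg0 : g 0 = l := by ext k; simp [g]
  have hden : ∀ᶠ s in 𝓝 (0 : ℂ), ∀ k, 1 - s * (c * l k) ≠ 0 := by
    rw [eventually_all]
    intro k
    have : ContinuousAt (fun s : ℂ => 1 - s * (c * l k)) 0 := by fun_prop
    exact this.eventually_ne (by simp)
  have hdet : ∀ᶠ s in 𝓝 (0 : ℂ), (1 + s * b) * 1 - (s * a) * (-(s * c)) ≠ 0 := by
    have : ContinuousAt (fun s : ℂ => (1 + s * b) * 1 - (s * a) * (-(s * c))) 0 := by fun_prop
    exact this.eventually_ne (by simp)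
  have hgd : HasDerivAt g (fun k => a + b * l k + c * l k ^ 2) 0 := by
    rw [hasDerivAt_pi]
    intro k
    have h1 : HasDerivAt (fun s : ℂ => l k + s * (a + b * l k)) (1 * (a + b * l k)) 0 :=
      ((hasDerivAt_id (0 : ℂ)).mul_const _).const_add _
    have h2 : HasDerivAt (fun s : ℂ => 1 - s * (c * l k)) (-(1 * (c * l k))) 0 :=
      ((hasDerivAt_id (0 : ℂ)).mul_const _).const_sub _
    have h3 : a + b * l k + c * l k ^ 2 = (1 * (a + b * l k) * (1 - 0 * (c * l k)) -
        (l k + 0 * (a + b * l k)) * -(1 * (c * l k))) / (1 - 0 * (c * l k)) ^ 2 := by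
      simp
      ring
    rw [h3]
    exact h1.div h2 (by simp)
  have hconst : (fun s => coefficientPullback f (diagonalPair (g s))) =ᶠ[𝓝 0]
      fun _ => coefficientPullback f (diagonalPair l) := by
    filter_upwards [hden, hdet] with s h1 h2
    have h3 : ∀ k, g s k * (-(s * c) * l k + 1) = (1 + s * b) * l k + s * a := by
      intro k
      have := h1 k
      simp only [g]
      rw [show -(s * c) * l k + 1 = 1 - s * (c * l k) by ring, div_mul_cancel₀ _ this]
      ring
    have h4 : ∀ k, -(s * c) * l k + 1 ≠ 0 := fun k h0 => h1 k (by rw [← h0]; ring)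
    have hinj : Function.Injective (g s) := by
      intro i j hij
      apply hl
      have e1 := h3 i
      have e2 := h3 j
      rw [hij] at e1
      have e3 : ((1 + s * b) * 1 - (s * a) * (-(s * c))) * (l i - l j) = 0 := by
        linear_combination (-(s * c) * l i + 1) * e2 - (-(s * c) * l j + 1) * e1
      exact sub_eq_zero.1 ((mul_eq_zero.1 e3).resolve_left h2)
    rw [coefficientPullback_diagonalPair hn hinj, coefficientPullback_diagonalPair hn hl,
      diagonalClass_moebius hn hl hinj h2 h4 h3]
  have hG' := hG.hasFDerivAt
  rw [← hg0] at hG'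
  have h1 := hG'.comp_hasDerivAt (0 : ℂ) hgd
  rw [hg0] at h1
  exact h1.unique ((hasDerivAt_const _ _).congr_of_eventuallyEq hconst)

end Holomorphy

/-! ### Cross-ratios and their derivatives. -/

section CrossRatio

variable {ι : Type*}

/-- The cross-ratio of `l k` with three fixed members of the family `l`. -/
noncomputable def crossRatio (i₀ i₁ i₂ : ι) (l : ι → ℂ) (k : ι) : ℂ :=
  (l k - l i₀) * (l i₁ - l i₂) / ((l k - l i₂) * (l i₁ - l i₀))

/-- If the denominator vanished, so would the numerator, against the nonzero determinant. -/
theorem moebius_den_ne_zero {a b c d x y : ℂ} (hdet : a * d - b * c ≠ 0)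
    (h : y * (c * x + d) = a * x + b) : c * x + d ≠ 0 := by
  intro h0
  have h1 : a * x + b = 0 := by rw [← h, h0, mul_zero]
  apply hdet
  by_cases hc : c = 0
  · subst hc
    have : d = 0 := by simpa using h0
    simp [this]
  · linear_combination a * h0 - c * h1

/-- Differences transform by `mᵢ - mⱼ = (ad - bc)(lᵢ - lⱼ) / ((c lᵢ + d)(c lⱼ + d))`. Numerator and
denominator acquire the same nonzero factor, so distinctness is not needed and values with zero
denominator agree as well. -/
theorem crossRatio_moebius (i₀ i₁ i₂ : ι) {l m : ι → ℂ} {a b c d : ℂ}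
    (hdet : a * d - b * c ≠ 0) (h : ∀ k, m k * (c * l k + d) = a * l k + b) :
    crossRatio i₀ i₁ i₂ m = crossRatio i₀ i₁ i₂ l := by
  have hden := fun k => moebius_den_ne_zero hdet (h k)
  have hsub : ∀ i j, m i - m j =
      (a * d - b * c) * (l i - l j) * ((c * l i + d)⁻¹ * (c * l j + d)⁻¹) := by
    intro i j
    rw [(eq_mul_inv_iff_mul_eq₀ (hden i)).2 (h i), (eq_mul_inv_iff_mul_eq₀ (hden j)).2 (h j)]
    have hi := inv_mul_cancel₀ (hden i)
    have hj := inv_mul_cancel₀ (hden j)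
    linear_combination (a * l j + b) * (c * l j + d)⁻¹ * hi - (a * l i + b) * (c * l i + d)⁻¹ * hj
  ext k
  have e0 := inv_ne_zero (hden i₀)
  have e1 := inv_ne_zero (hden i₁)
  have e2 := inv_ne_zero (hden i₂)
  have ek := inv_ne_zero (hden k)
  rw [crossRatio, crossRatio, hsub, hsub, hsub, hsub]
  generalize (c * l i₀ + d)⁻¹ = u₀ at *
  generalize (c * l i₁ + d)⁻¹ = u₁ at *
  generalize (c * l i₂ + d)⁻¹ = u₂ at *
  generalize (c * l k + d)⁻¹ = v at *
  have hfac : ((a * d - b * c) ^ 2 * (v * u₀ * u₁ * u₂)) ≠ 0 := by positivity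
  rw [← mul_div_mul_left ((l k - l i₀) * (l i₁ - l i₂)) _ hfac]
  congr 1 <;> ring

theorem exists_moebius_of_crossRatio_eq {i₀ i₁ i₂ : ι} (h01 : i₀ ≠ i₁) (h02 : i₀ ≠ i₂)
    (h12 : i₁ ≠ i₂) {l m : ι → ℂ} (hl : Function.Injective l) (hm : Function.Injective m)
    (h : crossRatio i₀ i₁ i₂ m = crossRatio i₀ i₁ i₂ l) :
    ∃ a b c d : ℂ, a * d - b * c ≠ 0 ∧ ∀ k, m k * (c * l k + d) = a * l k + b := by
  have L01 := sub_ne_zero.2 (hl.ne h01.symm)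
  have L02 := sub_ne_zero.2 (hl.ne h02.symm)
  have L12 := sub_ne_zero.2 (hl.ne h12)
  have M01 := sub_ne_zero.2 (hm.ne h01.symm)
  have M02 := sub_ne_zero.2 (hm.ne h02.symm)
  have M12 := sub_ne_zero.2 (hm.ne h12)
  -- Equality of cross-ratios with denominators cleared; at `k = i₂`, where the cross-ratio is a
  -- division by zero, both sides vanish anyway. The relation is affine in `m k` and in `l k`, and
  -- its coefficients are the matrix given below.
  have key : ∀ k, (l k - l i₀) * (l i₁ - l i₂) * ((m k - m i₂) * (m i₁ - m i₀)) =
      (m k - m i₀) * (m i₁ - m i₂) * ((l k - l i₂) * (l i₁ - l i₀)) := by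
    intro k
    by_cases hk : k = i₂
    · subst hk; ring
    · have Lk := sub_ne_zero.2 (hl.ne hk)
      have Mk := sub_ne_zero.2 (hm.ne hk)
      have := congrFun h k
      rw [crossRatio, crossRatio, div_eq_div_iff (mul_ne_zero Mk M01) (mul_ne_zero Lk L01)] at this
      exact this.symm
  refine ⟨(l i₁ - l i₂) * (m i₁ - m i₀) * m i₂ - (m i₁ - m i₂) * (l i₁ - l i₀) * m i₀,
    -((l i₁ - l i₂) * (m i₁ - m i₀) * m i₂ * l i₀) + (m i₁ - m i₂) * (l i₁ - l i₀) * m i₀ * l i₂,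
    (l i₁ - l i₂) * (m i₁ - m i₀) - (m i₁ - m i₂) * (l i₁ - l i₀),
    -((l i₁ - l i₂) * (m i₁ - m i₀) * l i₀) + (m i₁ - m i₂) * (l i₁ - l i₀) * l i₂, ?_, ?_⟩
  · have : ((l i₁ - l i₂) * (m i₁ - m i₀)) * ((m i₁ - m i₂) * (l i₁ - l i₀)) *
        ((m i₂ - m i₀) * (l i₂ - l i₀)) ≠ 0 := by positivity
    convert this using 1
    ring
  · intro k
    linear_combination key k

theorem differentiableAt_crossRatio [Fintype ι] {i₀ i₁ : ι} (h01 : i₀ ≠ i₁) (i₂ : ι) {l : ι → ℂ}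
    (hl : Function.Injective l) (k : ι) :
    DifferentiableAt ℂ (fun l => crossRatio i₀ i₁ i₂ l k) l := by
  by_cases hk : k = i₂
  · subst hk
    simp [crossRatio]
  · have Lk := sub_ne_zero.2 (hl.ne hk)
    have L01 := sub_ne_zero.2 (hl.ne h01.symm)
    have h1 : DifferentiableAt ℂ (fun l : ι → ℂ => (l k - l i₀) * (l i₁ - l i₂)) l := by fun_prop
    have h2 : DifferentiableAt ℂ (fun l : ι → ℂ => (l k - l i₂) * (l i₁ - l i₀)) l := by fun_prop
    simp only [crossRatio, div_eq_mul_inv]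
    exact h1.fun_mul (h2.fun_inv (mul_ne_zero Lk L01))

theorem exists_quadratic_interpolation {x₀ x₁ x₂ : ℂ} (h01 : x₁ - x₀ ≠ 0) (h02 : x₂ - x₀ ≠ 0)
    (h12 : x₂ - x₁ ≠ 0) (v₀ v₁ v₂ : ℂ) : ∃ a b c : ℂ, a + b * x₀ + c * x₀ ^ 2 = v₀ ∧
      a + b * x₁ + c * x₁ ^ 2 = v₁ ∧ a + b * x₂ + c * x₂ ^ 2 = v₂ := by
  obtain ⟨b, hb⟩ : ∃ b, b * (x₁ - x₀) = v₁ - v₀ := ⟨_, div_mul_cancel₀ _ h01⟩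
  obtain ⟨c, hc⟩ : ∃ c, c * ((x₂ - x₁) * (x₂ - x₀)) = v₂ - v₀ - b * (x₂ - x₀) :=
    ⟨_, div_mul_cancel₀ _ (mul_ne_zero h12 h02)⟩
  refine ⟨v₀ - b * x₀ + c * x₀ * x₁, b - c * (x₀ + x₁), c, by ring, ?_, ?_⟩
  · linear_combination hb
  · linear_combination hc

/-- Subtract from `v` the quadratic polynomial in `l` which agrees with it at the three base
indices. The quadratic part is an infinitesimal projective motion and does not change cross-ratios.
The remainder vanishes at the base indices but not at some `k`, and the cross-ratio of `l k` has
derivative a nonzero multiple of it. -/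
theorem exists_crossRatio_derivative_ne_zero {i₀ i₁ i₂ : ι} (h01 : i₀ ≠ i₁)
    (h02 : i₀ ≠ i₂) (h12 : i₁ ≠ i₂) {l v : ι → ℂ} (hl : Function.Injective l)
    (hv : ¬ ∃ a b c : ℂ, ∀ k, v k = a + b * l k + c * l k ^ 2) :
    ∃ k, k ≠ i₀ ∧ k ≠ i₁ ∧ k ≠ i₂ ∧ ∀ g : ℂ → ι → ℂ, g 0 = l →
      (∀ k, HasDerivAt (fun t => g t k) (v k) 0) →
      ∃ d, d ≠ 0 ∧ HasDerivAt (fun t => crossRatio i₀ i₁ i₂ (g t) k) d 0 := by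
  have L01 := sub_ne_zero.2 (hl.ne h01.symm)
  have L02 := sub_ne_zero.2 (hl.ne h02.symm)
  have L12 := sub_ne_zero.2 (hl.ne h12.symm)
  have L21 := sub_ne_zero.2 (hl.ne h12)
  obtain ⟨a, b, c, e0, e1, e2⟩ := exists_quadratic_interpolation L01 L02 L12 (v i₀) (v i₁) (v i₂)
  push Not at hv
  obtain ⟨k, hk⟩ := hv a b c
  have hk2 : k ≠ i₂ := by rintro rfl; exact hk e2.symm
  refine ⟨k, by rintro rfl; exact hk e0.symm, by rintro rfl; exact hk e1.symm, hk2,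
    fun g hg0 hg => ?_⟩
  have Lk := sub_ne_zero.2 (hl.ne hk2)
  have hD : (g 0 k - g 0 i₂) * (g 0 i₁ - g 0 i₀) ≠ 0 := by
    rw [hg0]; exact mul_ne_zero Lk L01
  have h := (((hg k).fun_sub (hg i₀)).fun_mul ((hg i₁).fun_sub (hg i₂))).fun_div
    (((hg k).fun_sub (hg i₂)).fun_mul ((hg i₁).fun_sub (hg i₀))) hD
  refine ⟨_, ?_, h⟩
  rw [hg0]
  -- `w` is the deviation of `v k` from the interpolating quadratic.
  obtain ⟨w, hw⟩ : ∃ w, v k = a + b * l k + c * l k ^ 2 + w := ⟨_, (add_sub_cancel _ _).symm⟩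
  have hw0 : w ≠ 0 := by
    rintro rfl
    exact hk (by rw [hw, add_zero])
  refine div_ne_zero ?_ (pow_ne_zero _ (mul_ne_zero Lk L01))
  have : w * (l i₁ - l i₂) * (l i₁ - l i₀) * -(l i₂ - l i₀) ≠ 0 := by
    have := neg_ne_zero.2 L02
    positivity
  convert this using 1
  rw [hw, ← e0, ← e1, ← e2]
  ring

end CrossRatio

/-! ### Four points and the Klein group. -/

section Klein

open Equiv in
/-- The Klein four group of permutations. -/
def kleinFour : List (Perm (Fin 4)) :=
  [1, swap 0 1 * swap 2 3, swap 0 2 * swap 1 3, swap 0 3 * swap 1 2]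

set_option maxRecDepth 100000 in
-- Every other coset of the Klein group contains a 3-cycle or a 4-cycle, whose square is not the
-- identity.
theorem mem_kleinFour_of_involutions : ∀ σ : Equiv.Perm (Fin 4),
    (∀ v ∈ kleinFour, (σ * v) * (σ * v) = 1) → σ ∈ kleinFour := by
  decide

theorem crossRatio_kleinFour {l : Fin 4 → ℂ} (hl : Function.Injective l)
    {v : Equiv.Perm (Fin 4)} (hv : v ∈ kleinFour) :
    crossRatio 0 1 2 (l ∘ v) = crossRatio 0 1 2 l := by
  have h01 := sub_ne_zero.2 (hl.ne (show (0 : Fin 4) ≠ 1 by decide))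
  have h02 := sub_ne_zero.2 (hl.ne (show (0 : Fin 4) ≠ 2 by decide))
  have h03 := sub_ne_zero.2 (hl.ne (show (0 : Fin 4) ≠ 3 by decide))
  have h12 := sub_ne_zero.2 (hl.ne (show (1 : Fin 4) ≠ 2 by decide))
  have h13 := sub_ne_zero.2 (hl.ne (show (1 : Fin 4) ≠ 3 by decide))
  have h23 := sub_ne_zero.2 (hl.ne (show (2 : Fin 4) ≠ 3 by decide))
  have h10 := sub_ne_zero.2 (hl.ne (show (1 : Fin 4) ≠ 0 by decide))
  have h20 := sub_ne_zero.2 (hl.ne (show (2 : Fin 4) ≠ 0 by decide))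
  have h30 := sub_ne_zero.2 (hl.ne (show (3 : Fin 4) ≠ 0 by decide))
  have h21 := sub_ne_zero.2 (hl.ne (show (2 : Fin 4) ≠ 1 by decide))
  have h31 := sub_ne_zero.2 (hl.ne (show (3 : Fin 4) ≠ 1 by decide))
  have h32 := sub_ne_zero.2 (hl.ne (show (3 : Fin 4) ≠ 2 by decide))
  have hvals : (v 0 = 0 ∧ v 1 = 1 ∧ v 2 = 2 ∧ v 3 = 3) ∨ (v 0 = 1 ∧ v 1 = 0 ∧ v 2 = 3 ∧ v 3 = 2) ∨
      (v 0 = 2 ∧ v 1 = 3 ∧ v 2 = 0 ∧ v 3 = 1) ∨ (v 0 = 3 ∧ v 1 = 2 ∧ v 2 = 1 ∧ v 3 = 0) := by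
    revert v
    decide
  ext k
  rcases hvals with ⟨e0, e1, e2, e3⟩ | ⟨e0, e1, e2, e3⟩ | ⟨e0, e1, e2, e3⟩ | ⟨e0, e1, e2, e3⟩ <;>
  fin_cases k <;>
  simp only [crossRatio, Function.comp_apply, Fin.zero_eta, Fin.mk_one, Fin.reduceFinMk,
    Fin.isValue, e0, e1, e2, e3] <;>
  -- At the base indices 0 and 2 both sides are zero, at 2 because of the convention for division by
  -- zero. The other indices are polynomial identities.
  first
  | simp only [sub_self, zero_mul, zero_div, div_zero]
  | rw [div_eq_div_iff (by positivity) (by positivity)]; ring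

end Klein

/-! ### Invariants that detect transverse variations. -/

section Invariant

variable {n : ℕ}

/-- If the projective transformations which permute the numbers `l k` are only those which exist
for all choices of these numbers, then each variation of `l` which is not induced by the
projective group is detected by an invariant. -/
theorem exists_invariant_derivative_ne_zero (hn : 3 ≤ n) {l v : Fin n → ℂ}
    (hl : Function.Injective l)
    (hgen : ∀ (a b c d : ℂ) (σ : Equiv.Perm (Fin n)), a * d - b * c ≠ 0 →
      (∀ k, l (σ k) * (c * l k + d) = a * l k + b) →
      (5 ≤ n → σ = 1) ∧ (n = 4 → σ * σ = 1))
    (hv : ¬ ∃ a b c : ℂ, ∀ k, v k = a + b * l k + c * l k ^ 2) :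
    ∃ F : (Fin n → ℂ) → ℂ,
      (∀ l m, Function.Injective l → Function.Injective m → MoebiusRelated l m → F l = F m) ∧
      (∀ l, Function.Injective l → DifferentiableAt ℂ F l) ∧
      ∀ g : ℂ → Fin n → ℂ, g 0 = l → HasDerivAt g v 0 →
        ∃ d, d ≠ 0 ∧ HasDerivAt (fun t => F (g t)) d 0 := by
  classical
  let i₀ : Fin n := ⟨0, by omega⟩
  let i₁ : Fin n := ⟨1, by omega⟩
  let i₂ : Fin n := ⟨2, by omega⟩
  have h01 : i₀ ≠ i₁ := by simp [i₀, i₁]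
  have h02 : i₀ ≠ i₂ := by simp [i₀, i₂]
  have h12 : i₁ ≠ i₂ := by simp [i₁, i₂]
  let C : (Fin n → ℂ) → Fin n → ℂ := crossRatio i₀ i₁ i₂
  obtain ⟨k₀, hk0, hk1, hk2, hk⟩ := exists_crossRatio_derivative_ne_zero h01 h02 h12 hl hv
  -- An index outside the three base ones exists. For `n = 3` every variation is quadratic, so that
  -- `hv` excludes this case.
  have hn4 : 4 ≤ n := by
    have h0 : (k₀ : ℕ) ≠ 0 := fun h => hk0 (Fin.ext h)
    have h1 : (k₀ : ℕ) ≠ 1 := fun h => hk1 (Fin.ext h)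
    have h2 : (k₀ : ℕ) ≠ 2 := fun h => hk2 (Fin.ext h)
    have := k₀.2
    omega
  -- Permutations preserving the cross-ratios of `l` preserve those of every family: for `n ≥ 5`
  -- they are trivial, and for `n = 4` they lie in the Klein group.
  have hS : ∀ σ : Equiv.Perm (Fin n), C (l ∘ σ) = C l →
      ∀ m, Function.Injective m → C (m ∘ σ) = C m := by
    have hinv : ∀ σ : Equiv.Perm (Fin n), C (l ∘ σ) = C l →
        (5 ≤ n → σ = 1) ∧ (n = 4 → σ * σ = 1) := by
      intro σ hσ
      obtain ⟨a, b, c, d, hdet, h⟩ := exists_moebius_of_crossRatio_eq h01 h02 h12 hl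
        (hl.comp σ.injective) hσ
      exact hgen a b c d σ hdet h
    rcases hn4.eq_or_lt with h4 | h5
    · subst h4
      intro σ hσ m hm
      -- Each product of `σ` with a Klein element again preserves the cross-ratios of `l`, hence has
      -- square 1 by the hypothesis on `l`.
      refine crossRatio_kleinFour hm (mem_kleinFour_of_involutions σ fun w hw => ?_)
      refine (hinv (σ * w) ?_).2 rfl
      exact (crossRatio_kleinFour (hl.comp σ.injective) hw).trans hσ
    · intro σ hσ m _
      rw [(hinv σ hσ).1 h5]
      rfl
  have hκ : ∀ σ : Equiv.Perm (Fin n), ∃ k, C (l ∘ σ) ≠ C l → C (l ∘ σ) k ≠ C l k := by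
    intro σ
    by_cases h : C (l ∘ σ) = C l
    · exact ⟨k₀, fun h' => absurd h h'⟩
    · obtain ⟨k, hk⟩ := Function.ne_iff.1 h
      exact ⟨k, fun _ => hk⟩
  choose κ hκ using hκ
  -- `S` consists of the reorderings which move the cross-ratio point `C l`. `R` vanishes to second
  -- order at all the points `C (l ∘ σ)` with `σ ∈ S` but not at `C l`, and `H` vanishes there only
  -- to first order, in the direction `k₀`.
  let S : Finset (Equiv.Perm (Fin n)) := {σ | C (l ∘ σ) ≠ C l}
  let R : (Fin n → ℂ) → ℂ := fun z => ∏ σ ∈ S, (z (κ σ) - C (l ∘ σ) (κ σ)) ^ 2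
  have hRd : Differentiable ℂ R := by fun_prop
  let H : (Fin n → ℂ) → ℂ := fun z => (z k₀ - C l k₀) * R z
  have hHd : Differentiable ℂ H := by fun_prop
  have hCd : ∀ m, Function.Injective m → DifferentiableAt ℂ C m := fun m hm =>
    differentiableAt_pi.2 fun k => differentiableAt_crossRatio h01 i₂ hm k
  have hFd : ∀ σ : Equiv.Perm (Fin n), ∀ m, Function.Injective m →
      DifferentiableAt ℂ (fun m => H (C (m ∘ σ))) m := by
    intro σ m hm
    have h1 : DifferentiableAt ℂ (fun m : Fin n → ℂ => m ∘ σ) m :=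
      differentiableAt_pi.2 fun k => differentiableAt_apply (σ k) m
    have h2 : DifferentiableAt ℂ (fun m : Fin n → ℂ => C (m ∘ σ)) m :=
      DifferentiableAt.comp (g := C) m (hCd _ (hm.comp σ.injective)) h1
    exact DifferentiableAt.comp (g := H) m (hHd _) h2
  -- Averaging over all permutations gives independence of the order of the roots; the cross-ratios
  -- already give projective invariance.
  refine ⟨fun m => ∑ σ : Equiv.Perm (Fin n), H (C (m ∘ σ)), ?_, fun m hm =>
    DifferentiableAt.fun_sum fun σ _ => hFd σ m hm, ?_⟩
  · rintro m m' hm hm' ⟨a, b, c, d, hdet, σ, h⟩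
    beta_reduce
    rw [← Equiv.sum_comp (Equiv.mulLeft σ)]
    refine Finset.sum_congr rfl fun τ _ => congrArg H ?_
    exact (crossRatio_moebius i₀ i₁ i₂ (l := m ∘ ⇑(σ * τ)) (m := m' ∘ τ) hdet
      fun k => h (τ k)).symm
  · intro g hg0 hg
    obtain ⟨d, hd0, hd⟩ := hk g hg0 (hasDerivAt_pi.1 hg)
    have hinj : ∀ᶠ t in 𝓝 (0 : ℂ), Function.Injective (g t) := by
      have hne : ∀ᶠ t in 𝓝 (0 : ℂ), ∀ i j, i ≠ j → g t i - g t j ≠ 0 := by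
        simp only [eventually_all]
        intro i j hij
        have hc : ∀ k, ContinuousAt (fun t => g t k) 0 := fun k =>
          (hasDerivAt_pi.1 hg k).continuousAt
        refine ((hc i).sub (hc j)).eventually_ne ?_
        rw [Pi.sub_apply, hg0]
        exact sub_ne_zero.2 (hl.ne hij)
      filter_upwards [hne] with t ht i j hij
      by_contra h
      exact ht i j h (sub_eq_zero.2 hij)
    have hCg : DifferentiableAt ℂ (fun t => C (g t)) 0 :=
      DifferentiableAt.comp (g := C) (0 : ℂ) (by rw [hg0]; exact hCd l hl) hg.differentiableAt
    have hR0 : R (C l) ≠ 0 := by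
      refine Finset.prod_ne_zero_iff.2 fun σ hσ => pow_ne_zero _ (sub_ne_zero.2 ?_)
      exact (hκ σ (by simpa [S] using hσ)).symm
    -- A term with `σ ∈ S` has a double zero at `t = 0` and contributes nothing. By `hS`, every
    -- other term coincides with the one of the identity, so these contributions add up without
    -- cancellation.
    have hterm : ∀ σ : Equiv.Perm (Fin n), HasDerivAt (fun t => H (C (g t ∘ σ)))
        (if σ ∈ S then 0 else d * R (C l)) 0 := by
      intro σ
      split_ifs with hσ
      · have hgσ : DifferentiableAt ℂ (fun t => C (g t ∘ σ)) 0 := by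
          have h1 : DifferentiableAt ℂ (fun t => g t ∘ σ) 0 :=
            differentiableAt_pi.2 fun k => (hasDerivAt_pi.1 hg (σ k)).differentiableAt
          exact DifferentiableAt.comp (g := C) (0 : ℂ)
            (by rw [hg0]; exact hCd _ (hl.comp σ.injective)) h1
        let A : ℂ → ℂ := fun t => C (g t ∘ σ) (κ σ) - C (l ∘ σ) (κ σ)
        let B : ℂ → ℂ := fun t => (C (g t ∘ σ) k₀ - C l k₀) *
          ∏ τ ∈ S.erase σ, (C (g t ∘ σ) (κ τ) - C (l ∘ τ) (κ τ)) ^ 2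
        have hA : DifferentiableAt ℂ A 0 := (differentiableAt_pi.1 hgσ _).sub_const _
        have hB : DifferentiableAt ℂ B 0 := by
          have hz : Differentiable ℂ fun z : Fin n → ℂ => (z k₀ - C l k₀) *
              ∏ τ ∈ S.erase σ, (z (κ τ) - C (l ∘ τ) (κ τ)) ^ 2 := by fun_prop
          exact (hz _).comp (0 : ℂ) hgσ
        have hA0 : A 0 = 0 := by simp [A, hg0]
        have heq : (fun t => H (C (g t ∘ σ))) = fun t => A t ^ 2 * B t := by
          ext t
          simp only [H, R, A, B]
          rw [← Finset.mul_prod_erase S _ hσ]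
          ring
        rw [heq]
        have h := (hA.hasDerivAt.fun_pow 2).fun_mul hB.hasDerivAt
        simpa [hA0] using h
      · have hσ' : C (l ∘ σ) = C l := by simpa [S] using hσ
        have heq : (fun t => H (C (g t ∘ σ))) =ᶠ[𝓝 0] fun t =>
            (C (g t) k₀ - C l k₀) * R (C (g t)) := by
          filter_upwards [hinj] with t ht
          rw [hS σ hσ' _ ht]
        refine HasDerivAt.congr_of_eventuallyEq ?_ heq
        have hRg : DifferentiableAt ℂ (fun t => R (C (g t))) 0 :=
          (hRd _).comp (0 : ℂ) hCg
        have h := (hd.sub_const (C l k₀)).fun_mul hRg.hasDerivAt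
        simp only [hg0] at h
        simpa [C] using h
    refine ⟨_, ?_, HasDerivAt.fun_sum fun σ _ => hterm σ⟩
    -- The total derivative is `d * R (C l)` times the number of permutations outside `S`, which
    -- include the identity.
    rw [Finset.sum_ite, Finset.sum_const_zero, zero_add, Finset.sum_const, nsmul_eq_mul]
    refine mul_ne_zero (Nat.cast_ne_zero.2 ?_) (mul_ne_zero hd0 hR0)
    refine Finset.card_ne_zero.2 ⟨1, ?_⟩
    simp [S]

end Invariant

/-! ### Projective automorphisms of the line of a pencil. -/

section GeneralPencils

variable {W : Type*} [AddCommGroup W] [Module ℂ W] {n : ℕ}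
  {Φ : Submodule ℂ (QuadraticForm ℂ W)} {θ₁ θ₂ : QuadraticForm ℂ W} {l : Fin n → ℂ}

/-- The matrix is chosen so that `θ₁ - l θ₂` goes to `(c l + d) θ₁ - (a l + b) θ₂`, i.e. the
parameter `l` is moved by the given homography. -/
theorem exists_pencil_automorphism (hli : LinearIndependent ℂ ![θ₁, θ₂])
    (hspan : Submodule.span ℂ {θ₁, θ₂} = Φ) (hΦ : Module.finrank ℂ Φ = 2) {a b c d : ℂ}
    (hdet : a * d - b * c ≠ 0) : ∃ g : Φ ≃ₗ[ℂ] Φ, ∀ v : Φ, ∀ x y : ℂ,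
      (v : QuadraticForm ℂ W) = x • θ₁ + y • θ₂ →
      (g v : QuadraticForm ℂ W) = x • (d • θ₁ + (-b) • θ₂) + y • ((-c) • θ₁ + a • θ₂) := by
  have hm : ∀ s t : ℂ, s • θ₁ + t • θ₂ ∈ Φ := fun s t =>
    hspan ▸ Submodule.mem_span_pair.2 ⟨s, t, rfl⟩
  have hm1 : θ₁ ∈ Φ := by simpa using hm 1 0
  have hm2 : θ₂ ∈ Φ := by simpa using hm 0 1
  have hli' : LinearIndependent ℂ ![d • θ₁ + (-b) • θ₂, (-c) • θ₁ + a • θ₂] := by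
    refine linearIndependent_of_finrank_span (Φ := Φ) ?_ hΦ
    rw [span_pair_eq_of_det_ne_zero, hspan]
    intro h0
    exact hdet (by linear_combination h0)
  have h1 : LinearIndependent ℂ ![(⟨θ₁, hm1⟩ : Φ), ⟨θ₂, hm2⟩] := by
    refine LinearIndependent.of_comp Φ.subtype ?_
    convert hli using 1
    ext i : 1
    fin_cases i <;> rfl
  have h2 : LinearIndependent ℂ ![(⟨_, hm d (-b)⟩ : Φ), ⟨_, hm (-c) a⟩] := by
    refine LinearIndependent.of_comp Φ.subtype ?_
    convert hli' using 1
    ext i : 1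
    fin_cases i <;> rfl
  have hfin : Module.Finite ℂ Φ := Module.finite_of_finrank_eq_succ hΦ
  let B₁ := basisOfLinearIndependentOfCardEqFinrank h1 (by simp [hΦ])
  let B₂ := basisOfLinearIndependentOfCardEqFinrank h2 (by simp [hΦ])
  let g : Φ ≃ₗ[ℂ] Φ := B₁.equiv B₂ (Equiv.refl _)
  have g1 : g ⟨θ₁, hm1⟩ = ⟨_, hm d (-b)⟩ := by
    have := B₁.equiv_apply 0 B₂ (Equiv.refl _)
    simpa [B₁, B₂, g] using this
  have g2 : g ⟨θ₂, hm2⟩ = ⟨_, hm (-c) a⟩ := by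
    have := B₁.equiv_apply 1 B₂ (Equiv.refl _)
    simpa [B₁, B₂, g] using this
  refine ⟨g, fun v x y hv => ?_⟩
  have hv' : v = x • ⟨θ₁, hm1⟩ + y • ⟨θ₂, hm2⟩ := Subtype.ext hv
  rw [hv', map_add, map_smul, map_smul, g1, g2]
  rfl

theorem HasRoots.perm_eq_of_isGeneralPencil [Module.Finite ℂ W] (hn : 2 ≤ n)
    (hW : Module.finrank ℂ W = n) (h : HasRoots Φ θ₁ θ₂ l) (hΦ : IsGeneralPencil Φ)
    {a b c d : ℂ} {σ : Equiv.Perm (Fin n)} (hdet : a * d - b * c ≠ 0)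
    (hσ : ∀ k, l (σ k) * (c * l k + d) = a * l k + b) :
    (5 ≤ n → σ = 1) ∧ (n = 4 → σ * σ = 1) := by
  have hli := h.linearIndependent hn
  obtain ⟨g, hg⟩ := exists_pencil_automorphism hli h.span_eq
    (h.isNonsingularPencil hn hW).finrank_eq hdet
  have hmap : ∀ k, Projectivization.map (g : Φ →ₗ[ℂ] Φ) g.injective
      (pencilPoint hli h.span_eq (l k)) = pencilPoint hli h.span_eq (l (σ k)) := by
    intro k
    rw [pencilPoint, Projectivization.map_mk, pencilPoint, Projectivization.mk_eq_mk_iff']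
    refine ⟨c * l k + d, Subtype.ext ?_⟩
    refine Eq.trans ?_ (hg _ 1 (-l k) (by
      rw [one_smul, neg_smul (M := QuadraticForm ℂ W), ← sub_eq_add_neg])).symm
    change (c * l k + d) • (θ₁ - l (σ k) • θ₂) = _
    linear_combination (norm := module) (-hσ k) • θ₂
  have hmem : ∀ p, p ∈ degeneratePoints Φ ↔ ∃ k, pencilPoint hli h.span_eq (l k) = p := by
    intro p
    rw [degeneratePoints_eq_range hli h.span_eq h.nondegenerate, h.setOf_eq_range hW]
    simp
  have hpres : ∀ p, Projectivization.map (g : Φ →ₗ[ℂ] Φ) g.injective p ∈ degeneratePoints Φ ↔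
      p ∈ degeneratePoints Φ := by
    intro p
    rw [hmem, hmem]
    constructor
    · rintro ⟨k, hk⟩
      refine ⟨σ.symm k, Projectivization.map_injective _ g.injective ?_⟩
      rw [hmap, Equiv.apply_symm_apply, hk]
    · rintro ⟨k, rfl⟩
      exact ⟨σ k, (hmap k).symm⟩
  have hinj := pencilPoint_injective hli h.span_eq
  obtain ⟨h5, h4⟩ := hΦ g hpres
  rw [hW] at h5 h4
  constructor
  · intro hn5
    ext k : 1
    have := h5 hn5 (pencilPoint hli h.span_eq (l k))
    rw [hmap] at this
    exact h.injective (hinj this)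
  · intro hn4
    ext k : 1
    have := h4 hn4 (pencilPoint hli h.span_eq (l k))
    rw [hmap, hmap] at this
    exact h.injective (hinj this)

end GeneralPencils

/-! ### Simultaneous diagonalization of two forms. -/

section Orthogonal

variable {W : Type*} [AddCommGroup W] [Module ℂ W] {n : ℕ}
  {θ₁ θ₂ : QuadraticForm ℂ W}

theorem associated_comm (θ : QuadraticForm ℂ W) (u v : W) :
    QuadraticMap.associated θ u v = QuadraticMap.associated θ v u :=
  QuadraticMap.associated_isSymm ℂ θ u v

theorem associated_eq_zero_of_ne {l : Fin n → ℂ} (hl : Function.Injective l) {e : Fin n → W}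
    (he : ∀ k j, QuadraticMap.associated θ₁ (e k) (e j) =
      l k * QuadraticMap.associated θ₂ (e k) (e j)) {k j : Fin n} (hkj : k ≠ j) :
    QuadraticMap.associated θ₂ (e k) (e j) = 0 := by
  have h1 := he k j
  have h2 := he j k
  rw [associated_comm θ₁, associated_comm θ₂, h1] at h2
  have h3 : (l k - l j) * QuadraticMap.associated θ₂ (e k) (e j) = 0 := by
    linear_combination h2
  exact (mul_eq_zero.1 h3).resolve_left (sub_ne_zero.2 (hl.ne hkj))

/-- The eigenvectors form a basis orthogonal for `θ₂`; an isotropic one would be orthogonal to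
everything. -/
theorem associated_self_ne_zero [Module.Finite ℂ W] (hW : Module.finrank ℂ W = n)
    (h : ¬ IsDegenerate θ₂) {l : Fin n → ℂ} (hl : Function.Injective l)
    {e : Fin n → W} (he0 : ∀ k, e k ≠ 0)
    (he : ∀ k v, QuadraticMap.associated θ₁ (e k) v =
      l k * QuadraticMap.associated θ₂ (e k) v) (k : Fin n) :
    QuadraticMap.associated θ₂ (e k) (e k) ≠ 0 := by
  intro h0
  have hspan := (linearIndependent_of_associated_eq h hl he0 he).span_eq_top_of_card_eq_finrank'
    (by simp [hW])
  refine h ⟨e k, he0 k, fun v => ?_⟩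
  have hv : v ∈ Submodule.span ℂ (Set.range e) := hspan ▸ Submodule.mem_top
  induction hv using Submodule.span_induction with
  | mem v hv =>
    obtain ⟨j, rfl⟩ := hv
    by_cases hkj : k = j
    · rw [← hkj, h0]
    · exact associated_eq_zero_of_ne hl (fun k j => he k (e j)) hkj
  | zero => exact map_zero _
  | add u v _ _ hu hv => rw [map_add, hu, hv, add_zero]
  | smul c v _ hv => rw [map_smul, hv, smul_zero]

/-- A basis of orthogonal eigenvectors can be normalized to a standard basis. -/
theorem exists_normalized_basis [Module.Finite ℂ W] (hW : Module.finrank ℂ W = n) {l : Fin n → ℂ}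
    {r : Fin n → W}
    (h2 : ∀ k j, k ≠ j → QuadraticMap.associated θ₂ (r k) (r j) = 0)
    (hne : ∀ k, QuadraticMap.associated θ₂ (r k) (r k) ≠ 0)
    (h1 : ∀ k j, QuadraticMap.associated θ₁ (r k) (r j) =
      l k * QuadraticMap.associated θ₂ (r k) (r j)) :
    ∃ (e : Module.Basis (Fin n) ℂ W) (d : Fin n → ℂ),
      (∀ k, d k ^ 2 = QuadraticMap.associated θ₂ (r k) (r k)) ∧ (∀ k, d k • e k = r k) ∧
      (∀ v k, e.repr v k = QuadraticMap.associated θ₂ v (e k)) ∧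
      (∀ z : Fin n → ℂ, θ₁ (∑ k, z k • e k) = ∑ k, l k * z k ^ 2) ∧
      (∀ z : Fin n → ℂ, θ₂ (∑ k, z k • e k) = ∑ k, z k ^ 2) := by
  classical
  -- The square roots `d k` are recorded because they are the coordinates of the vector that spans
  -- the poised subspace.
  have hsq : ∀ k, ∃ t : ℂ, t ^ 2 = QuadraticMap.associated θ₂ (r k) (r k) := fun k =>
    ⟨_, Complex.cpow_nat_inv_pow _ two_ne_zero⟩
  choose d hd using hsq
  have hd0 : ∀ k, d k ≠ 0 := fun k h0 => hne k (by rw [← hd, h0]; simp)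
  let e₀ : Fin n → W := fun k => (d k)⁻¹ • r k
  have b2 : ∀ k j, QuadraticMap.associated θ₂ (e₀ k) (e₀ j) = if k = j then 1 else 0 := by
    intro k j
    simp only [e₀, map_smul, LinearMap.smul_apply, smul_eq_mul]
    split_ifs with hkj
    · subst hkj
      rw [← hd]
      have := hd0 k
      field_simp
    · rw [h2 k j hkj]; simp
  have b1 : ∀ k j, QuadraticMap.associated θ₁ (e₀ k) (e₀ j) = if k = j then l k else 0 := by
    intro k j
    have : QuadraticMap.associated θ₁ (e₀ k) (e₀ j) =
        l k * QuadraticMap.associated θ₂ (e₀ k) (e₀ j) := by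
      simp only [e₀, map_smul, LinearMap.smul_apply, smul_eq_mul, h1]
      ring
    rw [this, b2]
    simp
  have hcoef : ∀ (z : Fin n → ℂ) j,
      QuadraticMap.associated θ₂ (∑ k, z k • e₀ k) (e₀ j) = z j := by
    intro z j
    simp [b2]
  have hli : LinearIndependent ℂ e₀ := by
    rw [Fintype.linearIndependent_iff]
    intro z hz j
    rw [← hcoef z j, hz, map_zero, LinearMap.zero_apply]
  have hspan := hli.span_eq_top_of_card_eq_finrank' (by rw [Fintype.card_fin, hW])
  let e := Module.Basis.mk hli hspan.ge
  have hee : ∀ k, e k = e₀ k := fun k => Module.Basis.mk_apply hli hspan.ge k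
  refine ⟨e, d, hd, fun k => ?_, fun v k => ?_, fun z => ?_, fun z => ?_⟩
  · rw [hee, smul_smul, mul_inv_cancel₀ (hd0 k), one_smul]
  · conv_rhs => rw [← e.sum_repr v]
    simp only [hee]
    rw [hcoef]
  · rw [← QuadraticMap.associated_eq_self_apply ℂ θ₁]
    simp only [hee, map_sum, map_smul, LinearMap.sum_apply, LinearMap.smul_apply, b1, smul_eq_mul,
      mul_ite, mul_zero, Finset.sum_ite_eq', Finset.mem_univ, if_true]
    exact Finset.sum_congr rfl fun k _ => by ring
  · rw [← QuadraticMap.associated_eq_self_apply ℂ θ₂]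
    simp only [hee, map_sum, map_smul, LinearMap.sum_apply, LinearMap.smul_apply, b2, smul_eq_mul,
      mul_ite, mul_zero, Finset.sum_ite_eq', Finset.mem_univ, if_true]
    exact Finset.sum_congr rfl fun k _ => by ring

end Orthogonal

/-! ### The intersection in diagonal coordinates. -/

section Frames

variable {n : ℕ} {ι : Type*} [Fintype ι]

/-- The pencil generated by `φ₁` and `φ₂` is also generated by `ψ₁ = ∑ αᵢ zᵢ²` and `ψ₂ = ∑ zᵢ²`, in
the coordinates of the basis `b`. -/
structure IsDiagonalFrame (φ₁ φ₂ ψ₁ ψ₂ : QuadraticForm ℂ (Fin (n + 3) → ℂ))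
    (b : Module.Basis ι ℂ (Fin (n + 3) → ℂ)) (α : ι → ℂ) : Prop where
  span_eq : Submodule.span ℂ {ψ₁, ψ₂} = Submodule.span ℂ {φ₁, φ₂}
  associated₁ : ∀ u v, QuadraticMap.associated ψ₁ u v = ∑ i, α i * (b.repr u i * b.repr v i)
  associated₂ : ∀ u v, QuadraticMap.associated ψ₂ u v = ∑ i, b.repr u i * b.repr v i

theorem associated_eq_of_standard {V : Type*} [AddCommGroup V] [Module ℂ V]
    (b : Module.Basis ι ℂ V) {ψ : QuadraticForm ℂ V} {α : ι → ℂ}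
    (h : ∀ z : ι → ℂ, ψ (∑ i, z i • b i) = ∑ i, α i * z i ^ 2) (u v : V) :
    QuadraticMap.associated ψ u v = ∑ i, α i * (b.repr u i * b.repr v i) := by
  have h' : ∀ u, ψ u = ∑ i, α i * b.repr u i ^ 2 := fun u => by
    conv_lhs => rw [← b.sum_repr u]
    exact h _
  rw [associated_eq, h', h', h', ← Finset.sum_sub_distrib, ← Finset.sum_sub_distrib,
    Finset.mul_sum]
  refine Finset.sum_congr rfl fun i _ => ?_
  rw [map_add, Finsupp.add_apply]
  ring

theorem repr_equivFun_symm {V : Type*} [AddCommGroup V] [Module ℂ V]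
    (b : Module.Basis ι ℂ V) (z : ι → ℂ) (i : ι) : b.repr (b.equivFun.symm z) i = z i :=
  congrFun (b.equivFun.apply_symm_apply z) i

theorem ext_repr {κ V : Type*} [AddCommGroup V] [Module ℂ V]
    (b : Module.Basis κ ℂ V) {u v : V} (h : ∀ i, b.repr u i = b.repr v i) : u = v :=
  b.repr.injective (Finsupp.ext h)

variable {φ₁ φ₂ ψ₁ ψ₂ : QuadraticForm ℂ (Fin (n + 3) → ℂ)}
  {b : Module.Basis ι ℂ (Fin (n + 3) → ℂ)} {α : ι → ℂ}

theorem mem_span_pair_trans {M : Type*} [AddCommGroup M] [Module ℂ M] {u v u' v' : M}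
    (h : Submodule.span ℂ {u, v} = Submodule.span ℂ {u', v'}) :
    (∃ x y : ℂ, x • u + y • v = u') ∧ ∃ x y : ℂ, x • u + y • v = v' :=
  ⟨Submodule.mem_span_pair.1 (h ▸ Submodule.subset_span (by simp)),
    Submodule.mem_span_pair.1 (h ▸ Submodule.subset_span (by simp))⟩

namespace IsDiagonalFrame

theorem apply₁ (h : IsDiagonalFrame φ₁ φ₂ ψ₁ ψ₂ b α) (u : Fin (n + 3) → ℂ) :
    ψ₁ u = ∑ i, α i * (b.repr u i * b.repr u i) := by
  rw [← h.associated₁, QuadraticMap.associated_eq_self_apply]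

theorem apply₂ (h : IsDiagonalFrame φ₁ φ₂ ψ₁ ψ₂ b α) (u : Fin (n + 3) → ℂ) :
    ψ₂ u = ∑ i, b.repr u i * b.repr u i := by
  rw [← h.associated₂, QuadraticMap.associated_eq_self_apply]

theorem mem_cone_iff (h : IsDiagonalFrame φ₁ φ₂ ψ₁ ψ₂ b α) {x : Fin (n + 3) → ℂ} :
    x ∈ cone φ₁ φ₂ ↔ x ≠ 0 ∧ ∑ i, α i * (b.repr x i * b.repr x i) = 0 ∧
      ∑ i, b.repr x i * b.repr x i = 0 := by
  rw [← h.apply₁, ← h.apply₂]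
  refine and_congr_right fun _ => ?_
  obtain ⟨⟨a, c, e1⟩, d, f, e2⟩ := mem_span_pair_trans h.span_eq
  obtain ⟨⟨a', c', e1'⟩, d', f', e2'⟩ := mem_span_pair_trans h.span_eq.symm
  constructor
  · rintro ⟨h1, h2⟩
    rw [← e1', ← e2']
    simp [h1, h2]
  · rintro ⟨h1, h2⟩
    rw [← e1, ← e2]
    simp [h1, h2]

theorem mem_affineTangent_iff_associated (h : IsDiagonalFrame φ₁ φ₂ ψ₁ ψ₂ b α)
    {x u : Fin (n + 3) → ℂ} : u ∈ affineTangent φ₁ φ₂ x ↔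
      QuadraticMap.associated ψ₁ x u = 0 ∧ QuadraticMap.associated ψ₂ x u = 0 := by
  rw [affineTangent, Submodule.mem_inf, LinearMap.mem_ker, LinearMap.mem_ker]
  obtain ⟨⟨a, c, e1⟩, d, f, e2⟩ := mem_span_pair_trans h.span_eq
  obtain ⟨⟨a', c', e1'⟩, d', f', e2'⟩ := mem_span_pair_trans h.span_eq.symm
  constructor
  · rintro ⟨h1, h2⟩
    rw [← e1', ← e2']
    simp [h1, h2]
  · rintro ⟨h1, h2⟩
    rw [← e1, ← e2]
    simp [h1, h2]

theorem mem_affineTangent_iff (h : IsDiagonalFrame φ₁ φ₂ ψ₁ ψ₂ b α) {x u : Fin (n + 3) → ℂ} :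
    u ∈ affineTangent φ₁ φ₂ x ↔ ∑ i, α i * (b.repr x i * b.repr u i) = 0 ∧
      ∑ i, b.repr x i * b.repr u i = 0 := by
  rw [h.mem_affineTangent_iff_associated, h.associated₁, h.associated₂]

theorem self_mem_affineTangent (h : IsDiagonalFrame φ₁ φ₂ ψ₁ ψ₂ b α) {x : Fin (n + 3) → ℂ}
    (hx : x ∈ cone φ₁ φ₂) : x ∈ affineTangent φ₁ φ₂ x :=
  h.mem_affineTangent_iff.2 (h.mem_cone_iff.1 hx).2

/-- If `αᵢ = αⱼ`, then `bᵢ + √-1 bⱼ` lies on the cone, and there the differential of `ψ₁` is `αᵢ`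
times that of `ψ₂`, so the intersection is singular. -/
theorem injective (h : IsDiagonalFrame φ₁ φ₂ ψ₁ ψ₂ b α)
    (hX : IsNonsingularIntersection φ₁ φ₂) : Function.Injective α := by
  classical
  intro i j hij
  by_contra hne
  let z : ι → ℂ := fun k => if k = i then 1 else if k = j then Complex.I else 0
  have hz : ∀ β : ι → ℂ, ∑ k, β k * (z k * z k) = β i - β j := by
    intro β
    have : ∀ k, β k * (z k * z k) = (if k = i then β i else 0) + (if k = j then -β j else 0) := by
      intro k
      simp only [z]
      by_cases hki : k = i
      · subst hki; simp [hne]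
      · by_cases hkj : k = j
        · subst hkj; simp [hki]
        · simp [hki, hkj]
    simp only [this, Finset.sum_add_distrib]
    simp [sub_eq_add_neg]
  let x := b.equivFun.symm z
  have hxz : ∀ k, b.repr x k = z k := repr_equivFun_symm b z
  have hx : x ∈ cone φ₁ φ₂ := by
    rw [h.mem_cone_iff]
    refine ⟨fun h0 => ?_, ?_, ?_⟩
    · have := hxz i
      rw [h0] at this
      simp [z] at this
    · simp only [hxz]
      rw [hz, hij, sub_self]
    · simp only [hxz]
      have := hz 1
      simpa using this
  have hli := hX x hx
  have hψ : QuadraticMap.associated ψ₁ x = α i • QuadraticMap.associated ψ₂ x := by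
    refine LinearMap.ext fun v => ?_
    rw [LinearMap.smul_apply, h.associated₁, h.associated₂, smul_eq_mul, Finset.mul_sum]
    refine Finset.sum_congr rfl fun k _ => ?_
    rw [hxz]
    by_cases hki : k = i
    · subst hki; rfl
    · by_cases hkj : k = j
      · subst hkj; rw [hij]
      · simp [z, hki, hkj]
  obtain ⟨⟨a, c, e1⟩, d, f, e2⟩ := mem_span_pair_trans h.span_eq
  rw [← e1, ← e2] at hli
  simp only [map_add, map_smul, LinearMap.add_apply, LinearMap.smul_apply, hψ] at hli
  have hcomb : ∀ s t : ℂ, s • α i • QuadraticMap.associated ψ₂ x +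
      t • QuadraticMap.associated ψ₂ x = (s * α i + t) • QuadraticMap.associated ψ₂ x +
        (0 : ℂ) • QuadraticMap.associated ψ₂ x := fun s t => by module
  rw [hcomb, hcomb] at hli
  exact det_ne_zero_of_linearIndependent hli (by ring)

end IsDiagonalFrame

/-! ### Curves on the cone with given velocity. -/

section Curves

theorem hasDerivAt_repr {κ : Type*} (b : Module.Basis κ ℂ (Fin (n + 3) → ℂ))
    {y : ℂ → Fin (n + 3) → ℂ} {v : Fin (n + 3) → ℂ} {t : ℂ}
    (h : HasDerivAt y v t) (i : κ) : HasDerivAt (fun t => b.repr (y t) i) (b.repr v i) t :=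
  ((b.coord i).toContinuousLinearMap.hasFDerivAt (x := y t)).comp_hasDerivAt t h

/-- Each pair of tangent vectors at a point with nonzero coordinates is given by a curve on the
cone and a family of tangent vectors along it. -/
theorem IsDiagonalFrame.exists_curve (h : IsDiagonalFrame φ₁ φ₂ ψ₁ ψ₂ b α)
    {x : Fin (n + 3) → ℂ} (hx : x ∈ cone φ₁ φ₂) (hgen : ∀ i, b.repr x i ≠ 0)
    {v w : Fin (n + 3) → ℂ} (hv : v ∈ affineTangent φ₁ φ₂ x) (hw : w ∈ affineTangent φ₁ φ₂ x) :
    ∃ y u : ℂ → Fin (n + 3) → ℂ, AnalyticAt ℂ y 0 ∧ AnalyticAt ℂ u 0 ∧ y 0 = x ∧ u 0 = w ∧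
      deriv y 0 = v ∧ ∀ᶠ t in 𝓝 (0 : ℂ), y t ∈ cone φ₁ φ₂ ∧ u t ∈ affineTangent φ₁ φ₂ (y t) := by
  -- The square root of `1 + 2 t vᵢ / xᵢ`. With `yᵢ = xᵢ sᵢ` the squares `yᵢ² = xᵢ² + 2 t xᵢ vᵢ` are
  -- linear in `t`, so the quadrics vanish exactly on the curve. With `uᵢ = wᵢ / sᵢ` the products
  -- `yᵢ uᵢ = xᵢ wᵢ` are constant, so tangency persists.
  let s : ι → ℂ → ℂ := fun i t =>
    Complex.exp (2⁻¹ * Complex.log (1 + t * (2 * (b.repr v i / b.repr x i))))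
  have hs0 : ∀ i, s i 0 = 1 := fun i => by simp [s]
  have hsne : ∀ i t, s i t ≠ 0 := fun i t => Complex.exp_ne_zero _
  have hsa : ∀ i, AnalyticAt ℂ (s i) 0 := by
    intro i
    have h1 : AnalyticAt ℂ (fun t : ℂ => 1 + t * (2 * (b.repr v i / b.repr x i))) 0 := by fun_prop
    exact (analyticAt_const.mul (h1.clog (by simp))).cexp
  have hsq : ∀ᶠ t in 𝓝 (0 : ℂ), ∀ i, s i t * s i t = 1 + t * (2 * (b.repr v i / b.repr x i)) := by
    rw [eventually_all]
    intro i
    have h1 : ContinuousAt (fun t : ℂ => 1 + t * (2 * (b.repr v i / b.repr x i))) 0 := by fun_prop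
    filter_upwards [h1.eventually_ne (y := 0) (by simp)] with t ht
    simp only [s]
    rw [← Complex.exp_add, ← add_mul, show (2⁻¹ + 2⁻¹ : ℂ) = 1 by norm_num, one_mul,
      Complex.exp_log ht]
  have hsd : ∀ i, HasDerivAt (s i) (b.repr v i / b.repr x i) 0 := by
    intro i
    have h1 : HasDerivAt (fun t : ℂ => 1 + t * (2 * (b.repr v i / b.repr x i)))
        (1 * (2 * (b.repr v i / b.repr x i))) 0 :=
      ((hasDerivAt_id (0 : ℂ)).mul_const _).const_add _
    have h2 := ((h1.clog (by simp)).const_mul (2⁻¹ : ℂ)).cexp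
    simpa using h2
  let L : (ι → ℂ) →L[ℂ] (Fin (n + 3) → ℂ) :=
    LinearMap.toContinuousLinearMap (b.equivFun.symm : (ι → ℂ) →ₗ[ℂ] (Fin (n + 3) → ℂ))
  have hL : ∀ z i, b.repr (L z) i = z i := fun z i => repr_equivFun_symm b z i
  have hLr : ∀ u, L (fun i => b.repr u i) = u := fun u => ext_repr b fun i => hL _ i
  let Y : ℂ → ι → ℂ := fun t i => b.repr x i * s i t
  let U : ℂ → ι → ℂ := fun t i => b.repr w i * (s i t)⁻¹
  have hYa : AnalyticAt ℂ Y 0 := analyticAt_pi_iff.2 fun i => analyticAt_const.mul (hsa i)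
  have hUa : AnalyticAt ℂ U 0 := analyticAt_pi_iff.2 fun i =>
    analyticAt_const.mul ((hsa i).inv (hsne i 0))
  have hYd : HasDerivAt Y (fun i => b.repr v i) 0 := by
    rw [hasDerivAt_pi]
    intro i
    have := (hsd i).const_mul (b.repr x i)
    rwa [mul_div_cancel₀ _ (hgen i)] at this
  have hY0 : L (Y 0) = x := by
    refine Eq.trans (congrArg L ?_) (hLr x)
    ext i
    simp [Y, hs0]
  refine ⟨fun t => L (Y t), fun t => L (U t), (L.analyticAt _).comp hYa, (L.analyticAt _).comp hUa,
    hY0, ?_, ?_, ?_⟩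
  · refine Eq.trans (congrArg L ?_) (hLr w)
    ext i
    simp [U, hs0]
  · refine ((L.hasFDerivAt (x := Y 0)).comp_hasDerivAt (0 : ℂ) hYd).deriv.trans (hLr v)
  · have hne : ∀ᶠ t in 𝓝 (0 : ℂ), L (Y t) ≠ 0 := by
      have hc : ContinuousAt (fun t => L (Y t)) 0 :=
        L.continuous.continuousAt.comp hYd.continuousAt
      exact hc.eventually_ne (by rw [hY0]; exact hx.1)
    rw [h.mem_affineTangent_iff] at hv hw
    have hx' := h.mem_cone_iff.1 hx
    filter_upwards [hne, hsq] with t ht hst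
    rw [h.mem_cone_iff, h.mem_affineTangent_iff]
    simp only [hL, Y, U]
    have e1 : ∀ i, b.repr x i * s i t * (b.repr x i * s i t) =
        b.repr x i * b.repr x i + 2 * t * (b.repr x i * b.repr v i) := by
      intro i
      have := hgen i
      have h2 := hst i
      calc _ = b.repr x i * b.repr x i * (s i t * s i t) := by ring
        _ = _ := by rw [h2]; field_simp
    have e2 : ∀ i, b.repr x i * s i t * (b.repr w i * (s i t)⁻¹) = b.repr x i * b.repr w i := by
      intro i
      have := hsne i t
      field_simp
    refine ⟨⟨ht, ?_, ?_⟩, ?_, ?_⟩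
    · have e3 : ∀ i, α i * (b.repr x i * b.repr x i + 2 * t * (b.repr x i * b.repr v i)) =
          α i * (b.repr x i * b.repr x i) + 2 * t * (α i * (b.repr x i * b.repr v i)) :=
        fun i => by ring
      simp only [e1, e3, Finset.sum_add_distrib, ← Finset.mul_sum, hx'.2.1, hv.1]
      ring
    · simp only [e1, Finset.sum_add_distrib, ← Finset.mul_sum, hx'.2.2, hv.2]
      ring
    · simp only [e2, hw.1]
    · simp only [e2, hw.2]

end Curves

/-! ### The second fundamental form as an induced pencil. -/

section SecondFundamentalForm

/-- `x` is in the radical of `ψ` on `x^⊥`, so `ψ` descends to the quotient. The descent is realized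
by a linear section, the choice of which changes vectors only by multiples of `x`. -/
theorem associated_tangentClass_comp {x : Fin (n + 3) → ℂ}
    (hx : x ∈ affineTangent φ₁ φ₂ x) {ψ : QuadraticForm ℂ (Fin (n + 3) → ℂ)}
    (hψ : ∀ u ∈ affineTangent φ₁ φ₂ x, QuadraticMap.associated ψ x u = 0) :
    ∃ q : QuadraticForm ℂ (TangentSpace φ₁ φ₂ x), ∀ v w : affineTangent φ₁ φ₂ x,
      QuadraticMap.associated q (tangentClass φ₁ φ₂ v) (tangentClass φ₁ φ₂ w) =
        QuadraticMap.associated ψ (v : Fin (n + 3) → ℂ) w := by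
  obtain ⟨s, hs⟩ := LinearMap.exists_rightInverse_of_surjective
    ((Submodule.span ℂ {x}).submoduleOf (affineTangent φ₁ φ₂ x)).mkQ
    (LinearMap.range_eq_top.2 (Submodule.mkQ_surjective _))
  have hs' : ∀ v : affineTangent φ₁ φ₂ x, ∃ c : ℂ,
      (s (tangentClass φ₁ φ₂ v) : Fin (n + 3) → ℂ) = v + c • x := by
    intro v
    have h1 : tangentClass φ₁ φ₂ (s (tangentClass φ₁ φ₂ v)) = tangentClass φ₁ φ₂ v :=
      LinearMap.congr_fun hs _
    rw [Submodule.Quotient.eq] at h1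
    have h2 : (s (tangentClass φ₁ φ₂ v) : Fin (n + 3) → ℂ) - v ∈ Submodule.span ℂ {x} := h1
    obtain ⟨c, hc⟩ := Submodule.mem_span_singleton.1 h2
    exact ⟨c, by rw [hc]; simp⟩
  refine ⟨ψ.comp ((affineTangent φ₁ φ₂ x).subtype ∘ₗ s), fun v w => ?_⟩
  rw [QuadraticMap.associated_comp]
  change QuadraticMap.associated ψ (s (tangentClass φ₁ φ₂ v) : Fin (n + 3) → ℂ)
    (s (tangentClass φ₁ φ₂ w)) = _
  obtain ⟨c, hc⟩ := hs' v
  obtain ⟨d, hd⟩ := hs' w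
  rw [hc, hd]
  simp only [map_add, map_smul, LinearMap.add_apply, LinearMap.smul_apply]
  rw [associated_comm ψ v x, hψ _ v.2, hψ _ w.2, hψ _ hx]
  simp

theorem exists_combination_of_forall_affineTangent (h : IsDiagonalFrame φ₁ φ₂ ψ₁ ψ₂ b α)
    {x : Fin (n + 3) → ℂ} {ℓ : Module.Dual ℂ (Fin (n + 3) → ℂ)}
    (hℓ : ∀ u ∈ affineTangent φ₁ φ₂ x, ℓ u = 0) : ∃ c d : ℂ, ∀ u,
      ℓ u = c * QuadraticMap.associated ψ₁ x u + d * QuadraticMap.associated ψ₂ x u := by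
  have hmem : ℓ ∈ Submodule.span ℂ
      (Set.range ![QuadraticMap.associated ψ₁ x, QuadraticMap.associated ψ₂ x]) := by
    refine mem_span_of_iInf_ker_le_ker fun u hu => ?_
    rw [Submodule.mem_iInf] at hu
    exact hℓ u (h.mem_affineTangent_iff_associated.2 ⟨hu 0, hu 1⟩)
  rw [show Set.range ![QuadraticMap.associated ψ₁ x, QuadraticMap.associated ψ₂ x] =
    {QuadraticMap.associated ψ₁ x, QuadraticMap.associated ψ₂ x} by simp [Set.pair_comm]] at hmem
  obtain ⟨c, d, hcd⟩ := Submodule.mem_span_pair.1 hmem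
  exact ⟨c, d, fun u => by rw [← hcd]; rfl⟩

/-- The second fundamental form at a point with nonzero coordinates is the pencil of the forms
induced on the tangent space by the quadrics through `X`. -/
theorem IsDiagonalFrame.secondFundamentalForm_eq (h : IsDiagonalFrame φ₁ φ₂ ψ₁ ψ₂ b α)
    {x : Fin (n + 3) → ℂ} (hx : x ∈ cone φ₁ φ₂) (hgen : ∀ i, b.repr x i ≠ 0)
    {q₁ q₂ : QuadraticForm ℂ (TangentSpace φ₁ φ₂ x)}
    (hq₁ : ∀ v w : affineTangent φ₁ φ₂ x,
      QuadraticMap.associated q₁ (tangentClass φ₁ φ₂ v) (tangentClass φ₁ φ₂ w) =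
        QuadraticMap.associated ψ₁ (v : Fin (n + 3) → ℂ) w)
    (hq₂ : ∀ v w : affineTangent φ₁ φ₂ x,
      QuadraticMap.associated q₂ (tangentClass φ₁ φ₂ v) (tangentClass φ₁ φ₂ w) =
        QuadraticMap.associated ψ₂ (v : Fin (n + 3) → ℂ) w) :
    secondFundamentalForm φ₁ φ₂ x = Submodule.span ℂ {q₁, q₂} := by
  -- Differentiating the tangency equation `ψ(y, w) = 0` gives `ψ(y', w) = -ψ(x, w')`: the
  -- functional `-ψ(x, ·)` on the normal space corresponds to the form induced by `ψ`.
  have hderiv : ∀ (y w : ℂ → Fin (n + 3) → ℂ), AnalyticAt ℂ y 0 → AnalyticAt ℂ w 0 → y 0 = x →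
      (∀ᶠ t in 𝓝 (0 : ℂ), y t ∈ cone φ₁ φ₂ ∧ w t ∈ affineTangent φ₁ φ₂ (y t)) →
      QuadraticMap.associated ψ₁ (deriv y 0) (w 0) =
        -QuadraticMap.associated ψ₁ x (deriv w 0) ∧
      QuadraticMap.associated ψ₂ (deriv y 0) (w 0) =
        -QuadraticMap.associated ψ₂ x (deriv w 0) := by
    intro y w hy hw h0 hyw
    have hy' := hy.differentiableAt.hasDerivAt
    have hw' := hw.differentiableAt.hasDerivAt
    have key : ∀ β : ι → ℂ, (∀ᶠ t in 𝓝 (0 : ℂ),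
        ∑ i, β i * (b.repr (y t) i * b.repr (w t) i) = 0) →
        ∑ i, β i * (b.repr (deriv y 0) i * b.repr (w 0) i) =
          -∑ i, β i * (b.repr x i * b.repr (deriv w 0) i) := by
      intro β hβ
      have h1 : HasDerivAt (fun t => ∑ i, β i * (b.repr (y t) i * b.repr (w t) i))
          (∑ i, β i * (b.repr (deriv y 0) i * b.repr (w 0) i +
            b.repr (y 0) i * b.repr (deriv w 0) i)) 0 :=
        HasDerivAt.fun_sum fun i _ =>
          ((hasDerivAt_repr b hy' i).fun_mul (hasDerivAt_repr b hw' i)).const_mul _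
      have h2 := h1.unique ((hasDerivAt_const (0 : ℂ) (0 : ℂ)).congr_of_eventuallyEq hβ)
      rw [h0] at h2
      simp only [mul_add, Finset.sum_add_distrib] at h2
      exact eq_neg_of_add_eq_zero_left h2
    constructor
    · rw [h.associated₁, h.associated₁]
      exact key α (hyw.mono fun t ht => (h.mem_affineTangent_iff.1 ht.2).1)
    · have := key 1 (hyw.mono fun t ht => by
        simpa using (h.mem_affineTangent_iff.1 ht.2).2)
      rw [h.associated₂, h.associated₂]
      simpa using this
  apply le_antisymm
  · rintro ψ ⟨ℓ, hℓ, hcurve⟩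
    obtain ⟨c, d, hcd⟩ := exists_combination_of_forall_affineTangent h hℓ
    refine Submodule.mem_span_pair.2 ⟨-c, -d, ?_⟩
    ext T
    induction T using Submodule.Quotient.induction_on with
    | H v =>
      obtain ⟨y, u, hy, hu, hy0, hu0, hyv, hev⟩ := h.exists_curve hx hgen v.2 v.2
      have h1 := hcurve y u hy hu hy0 hev v v hyv hu0
      obtain ⟨d1, d2⟩ := hderiv y u hy hu hy0 hev
      rw [hyv, hu0, ← hq₁] at d1
      rw [hyv, hu0, ← hq₂] at d2
      rw [hcd] at h1
      rw [QuadraticMap.associated_eq_self_apply] at h1 d1 d2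
      rw [_root_.add_apply, _root_.smul_apply, _root_.smul_apply, d1, d2, h1]
      simp
  · rw [Submodule.span_le, Set.pair_subset_iff]
    constructor
    · refine ⟨-QuadraticMap.associated ψ₁ x, fun u hu => ?_, ?_⟩
      · rw [LinearMap.neg_apply, (h.mem_affineTangent_iff_associated.1 hu).1, neg_zero]
      · intro y w hy hw h0 hyw v₀ w₀ hv₀ hw₀
        rw [hq₁, ← hv₀, ← hw₀, (hderiv y w hy hw h0 hyw).1]
        rfl
    · refine ⟨-QuadraticMap.associated ψ₂ x, fun u hu => ?_, ?_⟩
      · rw [LinearMap.neg_apply, (h.mem_affineTangent_iff_associated.1 hu).2, neg_zero]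
      · intro y w hy hw h0 hyw v₀ w₀ hv₀ hw₀
        rw [hq₂, ← hv₀, ← hw₀, (hderiv y w hy hw h0 hyw).2]
        rfl

end SecondFundamentalForm

end Frames

/-! ### Eigenvectors on the tangent space and motion of the roots. -/

section TangentEigenvectors

variable {n : ℕ} {ι : Type*} [Fintype ι]
  {φ₁ φ₂ ψ₁ ψ₂ : QuadraticForm ℂ (Fin (n + 3) → ℂ)}
  {b : Module.Basis ι ℂ (Fin (n + 3) → ℂ)} {α : ι → ℂ}

/-- The vector `(α - μ)⁻¹ x`. -/
noncomputable def resolventVector (b : Module.Basis ι ℂ (Fin (n + 3) → ℂ)) (α : ι → ℂ)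
    (x : Fin (n + 3) → ℂ) (μ : ℂ) : Fin (n + 3) → ℂ :=
  b.equivFun.symm fun i => b.repr x i / (α i - μ)

theorem repr_resolventVector (x : Fin (n + 3) → ℂ) (μ : ℂ) (i : ι) :
    b.repr (resolventVector b α x μ) i = b.repr x i / (α i - μ) :=
  repr_equivFun_symm b _ i

/-- `μ` is a root of the discriminant of the second fundamental form at `x`. -/
structure IsTangentRoot (b : Module.Basis ι ℂ (Fin (n + 3) → ℂ)) (α : ι → ℂ)
    (x : Fin (n + 3) → ℂ) (μ : ℂ) : Prop where
  ne : ∀ i, α i - μ ≠ 0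
  root : ∑ i, b.repr x i ^ 2 / (α i - μ) = 0
  simple : ∑ i, b.repr x i ^ 2 / (α i - μ) ^ 2 ≠ 0

variable {x : Fin (n + 3) → ℂ}

/-- Orthogonality to `x` for `ψ₂` is the root equation; for `ψ₁` it follows from `α / (α - μ) = 1 +
μ / (α - μ)` and `ψ₂(x) = 0`. -/
theorem IsDiagonalFrame.resolventVector_mem (h : IsDiagonalFrame φ₁ φ₂ ψ₁ ψ₂ b α)
    (hx : x ∈ cone φ₁ φ₂) {μ : ℂ} (hμ : IsTangentRoot b α x μ) :
    resolventVector b α x μ ∈ affineTangent φ₁ φ₂ x := by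
  rw [h.mem_affineTangent_iff]
  simp only [repr_resolventVector]
  have h2 : ∑ i, b.repr x i * (b.repr x i / (α i - μ)) = 0 := by
    rw [← hμ.root]
    exact Finset.sum_congr rfl fun i _ => by ring
  refine ⟨?_, h2⟩
  have h3 : ∀ i, α i * (b.repr x i * (b.repr x i / (α i - μ))) =
      b.repr x i * b.repr x i + μ * (b.repr x i * (b.repr x i / (α i - μ))) := by
    intro i
    have := hμ.ne i
    field_simp
    ring
  simp only [h3, Finset.sum_add_distrib, ← Finset.mul_sum, h2, (h.mem_cone_iff.1 hx).2.2]
  ring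

theorem IsDiagonalFrame.associated_resolventVector (h : IsDiagonalFrame φ₁ φ₂ ψ₁ ψ₂ b α)
    {μ : ℂ} (hμ : ∀ i, α i - μ ≠ 0) {w : Fin (n + 3) → ℂ} (hw : w ∈ affineTangent φ₁ φ₂ x) :
    QuadraticMap.associated ψ₁ (resolventVector b α x μ) w =
      μ * QuadraticMap.associated ψ₂ (resolventVector b α x μ) w := by
  rw [h.associated₁, h.associated₂]
  simp only [repr_resolventVector]
  have h3 : ∀ i, α i * (b.repr x i / (α i - μ) * b.repr w i) =
      b.repr x i * b.repr w i + μ * (b.repr x i / (α i - μ) * b.repr w i) := by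
    intro i
    have := hμ i
    field_simp
    ring
  simp only [h3, Finset.sum_add_distrib, ← Finset.mul_sum, (h.mem_affineTangent_iff.1 hw).2]
  ring

theorem IsDiagonalFrame.associated_resolventVector_self
    (h : IsDiagonalFrame φ₁ φ₂ ψ₁ ψ₂ b α) (x : Fin (n + 3) → ℂ) (μ : ℂ) :
    QuadraticMap.associated ψ₂ (resolventVector b α x μ) (resolventVector b α x μ) =
      ∑ i, b.repr x i ^ 2 / (α i - μ) ^ 2 := by
  rw [h.associated₂]
  simp only [repr_resolventVector]
  exact Finset.sum_congr rfl fun i _ => by rw [← sq, div_pow]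

/-- The forms `q₁`, `q₂` on the tangent space are induced by `ψ₁`, `ψ₂`. -/
structure IsInducedPair (φ₁ φ₂ ψ₁ ψ₂ : QuadraticForm ℂ (Fin (n + 3) → ℂ))
    (x : Fin (n + 3) → ℂ) (q₁ q₂ : QuadraticForm ℂ (TangentSpace φ₁ φ₂ x)) : Prop where
  eq₁ : ∀ v w : affineTangent φ₁ φ₂ x,
    QuadraticMap.associated q₁ (tangentClass φ₁ φ₂ v) (tangentClass φ₁ φ₂ w) =
      QuadraticMap.associated ψ₁ (v : Fin (n + 3) → ℂ) w
  eq₂ : ∀ v w : affineTangent φ₁ φ₂ x,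
    QuadraticMap.associated q₂ (tangentClass φ₁ φ₂ v) (tangentClass φ₁ φ₂ w) =
      QuadraticMap.associated ψ₂ (v : Fin (n + 3) → ℂ) w

theorem IsDiagonalFrame.exists_isInducedPair (h : IsDiagonalFrame φ₁ φ₂ ψ₁ ψ₂ b α)
    (hx : x ∈ cone φ₁ φ₂) : ∃ q₁ q₂, IsInducedPair φ₁ φ₂ ψ₁ ψ₂ x q₁ q₂ := by
  obtain ⟨q₁, h1⟩ := associated_tangentClass_comp (h.self_mem_affineTangent hx)
    fun u hu => (h.mem_affineTangent_iff_associated.1 hu).1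
  obtain ⟨q₂, h2⟩ := associated_tangentClass_comp (h.self_mem_affineTangent hx)
    fun u hu => (h.mem_affineTangent_iff_associated.1 hu).2
  exact ⟨q₁, q₂, h1, h2⟩

variable {q₁ q₂ : QuadraticForm ℂ (TangentSpace φ₁ φ₂ x)}

/-- The tangent vectors attached to the roots of the discriminant give a standard basis. -/
theorem IsDiagonalFrame.exists_tangent_basis (h : IsDiagonalFrame φ₁ φ₂ ψ₁ ψ₂ b α)
    (hX : IsNonsingularIntersection φ₁ φ₂) (hx : x ∈ cone φ₁ φ₂)
    (hq : IsInducedPair φ₁ φ₂ ψ₁ ψ₂ x q₁ q₂) {l : Fin n → ℂ} (hl : Function.Injective l)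
    (hroot : ∀ k, IsTangentRoot b α x (l k)) :
    ∃ (e : Module.Basis (Fin n) ℂ (TangentSpace φ₁ φ₂ x)) (d : Fin n → ℂ),
      (∀ k, d k ^ 2 = ∑ i, b.repr x i ^ 2 / (α i - l k) ^ 2) ∧
      (∀ (v : affineTangent φ₁ φ₂ x) k, d k * e.repr (tangentClass φ₁ φ₂ v) k =
        ∑ i, b.repr x i * b.repr (v : Fin (n + 3) → ℂ) i / (α i - l k)) ∧
      (∀ z : Fin n → ℂ, q₁ (∑ k, z k • e k) = ∑ k, l k * z k ^ 2) ∧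
      (∀ z : Fin n → ℂ, q₂ (∑ k, z k • e k) = ∑ k, z k ^ 2) := by
  let r : Fin n → affineTangent φ₁ φ₂ x := fun k =>
    ⟨resolventVector b α x (l k), h.resolventVector_mem hx (hroot k)⟩
  have h1 : ∀ k j, QuadraticMap.associated q₁ (tangentClass φ₁ φ₂ (r k))
      (tangentClass φ₁ φ₂ (r j)) = l k * QuadraticMap.associated q₂ (tangentClass φ₁ φ₂ (r k))
      (tangentClass φ₁ φ₂ (r j)) := by
    intro k j
    rw [hq.eq₁, hq.eq₂]
    exact h.associated_resolventVector (hroot k).ne (r j).2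
  have hself : ∀ k, QuadraticMap.associated q₂ (tangentClass φ₁ φ₂ (r k))
      (tangentClass φ₁ φ₂ (r k)) = ∑ i, b.repr x i ^ 2 / (α i - l k) ^ 2 := by
    intro k
    rw [hq.eq₂]
    exact h.associated_resolventVector_self x (l k)
  obtain ⟨e, d, hd, hde, hrepr, he1, he2⟩ := exists_normalized_basis
    (finrank_tangentSpace hX hx) (fun k j hkj => associated_eq_zero_of_ne hl h1 hkj)
    (fun k => by rw [hself]; exact (hroot k).simple) h1
  refine ⟨e, d, fun k => (hd k).trans (hself k), fun v k => ?_, he1, he2⟩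
  -- The coordinate is the pairing with `e k`, and `d k • e k` is the class of the resolvent vector.
  rw [hrepr, ← smul_eq_mul, ← map_smul, hde, hq.eq₂, h.associated₂]
  refine Finset.sum_congr rfl fun i _ => ?_
  rw [repr_resolventVector]
  ring

/-- Having `n` distinct tangent roots already forces the second fundamental form to be a nonsingular
pencil. This is applied to all nearby points of a curve, where only the root conditions are known to
persist. -/
theorem IsDiagonalFrame.moduliMap_eq (h : IsDiagonalFrame φ₁ φ₂ ψ₁ ψ₂ b α) (hn : 2 ≤ n)
    (hX : IsNonsingularIntersection φ₁ φ₂) (hx : x ∈ cone φ₁ φ₂) (hgen : ∀ i, b.repr x i ≠ 0)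
    {l : Fin n → ℂ} (hl : Function.Injective l) (hroot : ∀ k, IsTangentRoot b α x (l k)) :
    ∃ hx' : x ∈ openLocus φ₁ φ₂, moduliMap hX ⟨x, hx'⟩ = diagonalClass hn hl := by
  obtain ⟨q₁, q₂, hq⟩ := h.exists_isInducedPair hx
  obtain ⟨e, d, -, -, he1, he2⟩ := h.exists_tangent_basis hX hx hq hl hroot
  have hII := h.secondFundamentalForm_eq hx hgen hq.eq₁ hq.eq₂
  have hpull : pullbackPencil e.equivFun.symm (secondFundamentalForm φ₁ φ₂ x) =
      coefficientPencil (diagonalPair l) := by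
    rw [hII]
    exact pullbackPencil_eq_coefficientPencil _
      (fun z => by rw [e.equivFun_symm_apply]; exact he1 z)
      (fun z => by rw [e.equivFun_symm_apply]; exact he2 z)
  have hns : IsNonsingularPencil (secondFundamentalForm φ₁ φ₂ x) := by
    have h1 := (isNonsingularPencil_diagonalPair hn hl).pullback e.equivFun
    rwa [← hpull, pullbackPencil_trans, LinearEquiv.self_trans_symm, pullbackPencil_refl] at h1
  refine ⟨⟨hx, hns⟩, ?_⟩
  rw [moduliMap, moduliClass_eq _ _ _ e.equivFun.symm]
  exact congrArg (Quotient.mk (pencilSetoid n)) (Subtype.ext hpull)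

/-- The roots of the discriminant of the second fundamental form. -/
theorem IsDiagonalFrame.exists_isTangentRoot (h : IsDiagonalFrame φ₁ φ₂ ψ₁ ψ₂ b α)
    (hn : 2 ≤ n) (hX : IsNonsingularIntersection φ₁ φ₂) (hx : x ∈ cone φ₁ φ₂)
    (hgen : ∀ i, b.repr x i ≠ 0) (hq : IsInducedPair φ₁ φ₂ ψ₁ ψ₂ x q₁ q₂)
    (hns : IsNonsingularPencil (secondFundamentalForm φ₁ φ₂ x)) (hq₂ : ¬ IsDegenerate q₂) :
    ∃ l : Fin n → ℂ, HasRoots (secondFundamentalForm φ₁ φ₂ x) q₁ q₂ l ∧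
      ∀ k, IsTangentRoot b α x (l k) := by
  have hW := finrank_tangentSpace hX hx
  have hα := h.injective hX
  have hII := h.secondFundamentalForm_eq hx hgen hq.eq₁ hq.eq₂
  obtain ⟨l, hl⟩ := hns.exists_hasRoots hn hW hII.symm hq₂
  refine ⟨l, hl, ?_⟩
  choose U hU0 hU using fun k => isDegenerate_sub_smul_iff.1 (hl.degenerate k)
  intro k
  have hself := associated_self_ne_zero hW hq₂ hl.injective hU0 hU k
  obtain ⟨u, hu⟩ := Submodule.Quotient.mk_surjective _ (U k)
  have hu0 := hU0 k
  have hUk := hU k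
  rw [← hu] at hself hu0 hUk
  rw [hq.eq₂] at hself
  have hux : ∀ c : ℂ, (u : Fin (n + 3) → ℂ) ≠ c • x := by
    intro c hc
    refine hu0 ((Submodule.Quotient.mk_eq_zero _).2 ?_)
    exact Submodule.mem_span_singleton.2 ⟨c, hc.symm⟩
  -- For an eigenvector `u`, the functional `ψ₁(u, ·) - l ψ₂(u, ·)` vanishes on `x^⊥`, hence is a
  -- combination of `ψ₁(x, ·)` and `ψ₂(x, ·)`. In coordinates, `(αᵢ - l) uᵢ = (c αᵢ + d) xᵢ`.
  obtain ⟨c, d, hcd⟩ := exists_combination_of_forall_affineTangent h (x := x)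
    (ℓ := QuadraticMap.associated ψ₁ (u : Fin (n + 3) → ℂ) -
      l k • QuadraticMap.associated ψ₂ (u : Fin (n + 3) → ℂ)) (by
    intro w hw
    have := hUk (tangentClass φ₁ φ₂ ⟨w, hw⟩)
    rw [hq.eq₁, hq.eq₂] at this
    rw [LinearMap.sub_apply, LinearMap.smul_apply, smul_eq_mul, this, sub_self])
  have hcoord : ∀ i, (α i - l k) * b.repr (u : Fin (n + 3) → ℂ) i =
      (c * α i + d) * b.repr x i := by
    classical
    intro i
    have := hcd (b i)
    simp only [LinearMap.sub_apply, LinearMap.smul_apply, h.associated₁, h.associated₂,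
      b.repr_self, smul_eq_mul, Finsupp.single_apply, mul_ite, mul_one, mul_zero,
      Finset.sum_ite_eq, Finset.mem_univ, if_true] at this
    linear_combination this
  have hxx := (h.mem_cone_iff.1 hx).2.2
  have hxu := (h.mem_affineTangent_iff.1 u.2).2
  -- If `l = αᵢ`, then `c αᵢ + d = 0`, so `u - c x` has only its `i`-th coordinate possibly nonzero.
  -- Being orthogonal to `x`, it vanishes, against `u ∉ ℂ x`.
  have hne : ∀ i, α i - l k ≠ 0 := by
    intro i hi
    have h1 : c * α i + d = 0 := by
      have := hcoord i
      rw [hi, zero_mul, eq_comm, mul_eq_zero] at this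
      exact this.resolve_right (hgen i)
    have h2 : ∀ j, j ≠ i → b.repr (u : Fin (n + 3) → ℂ) j - c * b.repr x j = 0 := by
      intro j hj
      have h3 : (α j - α i) * (b.repr (u : Fin (n + 3) → ℂ) j - c * b.repr x j) = 0 := by
        linear_combination hcoord j - b.repr (u : Fin (n + 3) → ℂ) j * hi + b.repr x j * h1
      exact (mul_eq_zero.1 h3).resolve_left (sub_ne_zero.2 (hα.ne hj))
    have h3 : ∑ j, b.repr x j * (b.repr (u : Fin (n + 3) → ℂ) j - c * b.repr x j) = 0 := by
      have : ∀ j, b.repr x j * (b.repr (u : Fin (n + 3) → ℂ) j - c * b.repr x j) =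
          b.repr x j * b.repr (u : Fin (n + 3) → ℂ) j - c * (b.repr x j * b.repr x j) :=
        fun j => by ring
      simp only [this, Finset.sum_sub_distrib, ← Finset.mul_sum, hxu, hxx]
      ring
    rw [Finset.sum_eq_single i (fun j _ hj => by rw [h2 j hj, mul_zero]) (by simp)] at h3
    have h4 := (mul_eq_zero.1 h3).resolve_left (hgen i)
    refine hux c (ext_repr b fun j => ?_)
    rw [map_smul, Finsupp.smul_apply, smul_eq_mul, ← sub_eq_zero]
    by_cases hj : j = i
    · rw [hj]; exact h4
    · exact h2 j hj
  -- `u = c x + (c l + d) (α - l)⁻¹ x`. Pairing with `x` gives the root equation, and `ψ₂(u, u) ≠ 0`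
  -- gives simplicity.
  have hudecomp : ∀ i, b.repr (u : Fin (n + 3) → ℂ) i =
      c * b.repr x i + (c * l k + d) * (b.repr x i / (α i - l k)) := by
    intro i
    have h1 := hne i
    have h2 := hcoord i
    field_simp
    linear_combination h2
  have hcd0 : c * l k + d ≠ 0 := by
    intro h0
    refine hux c (ext_repr b fun i => ?_)
    rw [hudecomp, h0, map_smul, Finsupp.smul_apply, smul_eq_mul]
    ring
  have hroot : ∑ i, b.repr x i ^ 2 / (α i - l k) = 0 := by
    have h1 : ∀ i, b.repr x i * b.repr (u : Fin (n + 3) → ℂ) i =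
        c * (b.repr x i * b.repr x i) + (c * l k + d) * (b.repr x i ^ 2 / (α i - l k)) := by
      intro i
      rw [hudecomp]
      ring
    simp only [h1, Finset.sum_add_distrib, ← Finset.mul_sum, hxx, mul_zero, zero_add] at hxu
    exact (mul_eq_zero.1 hxu).resolve_left hcd0
  refine ⟨hne, hroot, fun h0 => hself ?_⟩
  rw [h.associated₂]
  have h1 : ∀ i, b.repr (u : Fin (n + 3) → ℂ) i * b.repr (u : Fin (n + 3) → ℂ) i =
      c ^ 2 * (b.repr x i * b.repr x i) + 2 * c * (c * l k + d) *
        (b.repr x i ^ 2 / (α i - l k)) +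
        (c * l k + d) ^ 2 * (b.repr x i ^ 2 / (α i - l k) ^ 2) := by
    intro i
    rw [hudecomp]
    have := hne i
    field_simp
    ring
  simp only [h1, Finset.sum_add_distrib, ← Finset.mul_sum, hxx, hroot, h0]
  ring

/-- The roots of the discriminant of the second fundamental form along a curve on the cone. -/
theorem IsDiagonalFrame.exists_root_curve (h : IsDiagonalFrame φ₁ φ₂ ψ₁ ψ₂ b α) (hn : 2 ≤ n)
    (hX : IsNonsingularIntersection φ₁ φ₂) (hgen : ∀ i, b.repr x i ≠ 0)
    {l : Fin n → ℂ} (hl : Function.Injective l) (hroot : ∀ k, IsTangentRoot b α x (l k))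
    {y : ℂ → Fin (n + 3) → ℂ} {v : Fin (n + 3) → ℂ} (hy : HasDerivAt y v 0) (hy0 : y 0 = x)
    (hyX : ∀ᶠ t in 𝓝 (0 : ℂ), y t ∈ cone φ₁ φ₂) :
    ∃ (g : ℂ → Fin n → ℂ) (g' : Fin n → ℂ), g 0 = l ∧ HasDerivAt g g' 0 ∧
      (∀ k, g' k * ∑ i, b.repr x i ^ 2 / (α i - l k) ^ 2 =
        -2 * ∑ i, b.repr x i * b.repr v i / (α i - l k)) ∧
      ∀ᶠ t in 𝓝 (0 : ℂ), ∃ hg : Function.Injective (g t), ∃ hy : y t ∈ openLocus φ₁ φ₂,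
        moduliMap hX ⟨y t, hy⟩ = diagonalClass hn hg := by
  let Z : ℂ → ι → ℂ := fun t i => b.repr (y t) i
  have hZ : HasDerivAt Z (fun i => b.repr v i) 0 := hasDerivAt_pi.2 (hasDerivAt_repr b hy)
  have hZ0 : Z 0 = fun i => b.repr x i := by ext i; simp [Z, hy0]
  let p : (ι → ℂ) × ℂ → ℂ := fun zμ => ∑ i, zμ.1 i ^ 2 / (α i - zμ.2)
  have hex : ∀ k, ∃ ρ : (ι → ℂ) → ℂ, ρ (Z 0) = l k ∧ (∀ᶠ z in 𝓝 (Z 0), p (z, ρ z) = 0) ∧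
      DifferentiableAt ℂ ρ (Z 0) := by
    intro k
    refine exists_implicit_root (d := ∑ i, b.repr x i ^ 2 / (α i - l k) ^ 2) ?_ ?_ ?_
      (hroot k).simple
    · refine ContDiffAt.sum fun i _ => ContDiffAt.div ?_ ?_ ((hroot k).ne i)
      · fun_prop
      · fun_prop
    · simp only [p, hZ0]
      exact (hroot k).root
    · simp only [p, hZ0]
      refine HasDerivAt.fun_sum fun i _ => ?_
      have h1 := (hasDerivAt_const (l k) (b.repr x i ^ 2)).fun_div
        ((hasDerivAt_id (l k)).const_sub (α i)) ((hroot k).ne i)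
      simpa using h1
  choose ρ hρ0 hρ hρd using hex
  let g : ℂ → Fin n → ℂ := fun t k => ρ k (Z t)
  have hgd : ∀ k, DifferentiableAt ℂ (fun t => g t k) 0 := fun k =>
    DifferentiableAt.comp (g := ρ k) (0 : ℂ) (hρd k) hZ.differentiableAt
  have hg0 : g 0 = l := funext hρ0
  have hgp : ∀ k, ∀ᶠ t in 𝓝 (0 : ℂ), ∑ i, b.repr (y t) i ^ 2 / (α i - g t k) = 0 :=
    fun k => hZ.continuousAt.eventually (hρ k)
  have hyc : ∀ i, ContinuousAt (fun t => b.repr (y t) i) 0 := fun i =>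
    (hasDerivAt_repr b hy i).continuousAt
  have hgc : ∀ k, ContinuousAt (fun t => g t k) 0 := fun k => (hgd k).continuousAt
  have hyg : ∀ᶠ t in 𝓝 (0 : ℂ), ∀ i, b.repr (y t) i ≠ 0 := by
    rw [eventually_all]
    intro i
    exact (hyc i).eventually_ne (by rw [hy0]; exact hgen i)
  have hne : ∀ᶠ t in 𝓝 (0 : ℂ), ∀ k i, α i - g t k ≠ 0 := by
    simp only [eventually_all]
    intro k i
    have : ContinuousAt (fun t => α i - g t k) 0 := continuousAt_const.sub (hgc k)
    exact this.eventually_ne (by rw [hg0]; exact (hroot k).ne i)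
  have hsimple : ∀ᶠ t in 𝓝 (0 : ℂ), ∀ k, ∑ i, b.repr (y t) i ^ 2 / (α i - g t k) ^ 2 ≠ 0 := by
    rw [eventually_all]
    intro k
    have : ContinuousAt (fun t => ∑ i, b.repr (y t) i ^ 2 / (α i - g t k) ^ 2) 0 := by
      refine tendsto_finsetSum _ fun i _ => ?_
      refine ContinuousAt.div ((hyc i).pow 2) ((continuousAt_const.sub (hgc k)).pow 2) ?_
      rw [hg0]
      exact pow_ne_zero _ ((hroot k).ne i)
    exact this.eventually_ne (by rw [hy0, hg0]; exact (hroot k).simple)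
  have hinj : ∀ᶠ t in 𝓝 (0 : ℂ), Function.Injective (g t) := by
    have hne : ∀ᶠ t in 𝓝 (0 : ℂ), ∀ i j, i ≠ j → g t i - g t j ≠ 0 := by
      simp only [eventually_all]
      intro i j hij
      have : ContinuousAt (fun t => g t i - g t j) 0 := (hgc i).sub (hgc j)
      exact this.eventually_ne (by rw [hg0]; exact sub_ne_zero.2 (hl.ne hij))
    filter_upwards [hne] with t ht i j hij
    by_contra h
    exact ht i j h (sub_eq_zero.2 hij)
  refine ⟨g, fun k => deriv (fun t => g t k) 0, hg0,
    hasDerivAt_pi.2 fun k => (hgd k).hasDerivAt, fun k => ?_, ?_⟩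
  -- Implicit differentiation of `∑ yᵢ² / (αᵢ - g) = 0` along the curve.
  · have h1 : HasDerivAt (fun t => ∑ i, b.repr (y t) i ^ 2 / (α i - g t k))
        (∑ i, (2 * (b.repr x i * b.repr v i / (α i - l k)) +
          deriv (fun t => g t k) 0 * (b.repr x i ^ 2 / (α i - l k) ^ 2))) 0 := by
      refine HasDerivAt.fun_sum fun i _ => ?_
      have h2 := ((hasDerivAt_repr b hy i).fun_pow 2).fun_div
        ((hgd k).hasDerivAt.const_sub (α i)) (by rw [hg0]; exact (hroot k).ne i)
      rw [hy0, hg0] at h2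
      have h3 : 2 * (b.repr x i * b.repr v i / (α i - l k)) +
          deriv (fun t => g t k) 0 * (b.repr x i ^ 2 / (α i - l k) ^ 2) =
          (((2 : ℕ) : ℂ) * b.repr x i ^ (2 - 1) * b.repr v i * (α i - l k) -
            b.repr x i ^ 2 * -deriv (fun t => g t k) 0) / (α i - l k) ^ 2 := by
        have := (hroot k).ne i
        push_cast
        field_simp
        ring
      rw [h3]
      exact h2
    have h2 := h1.unique ((hasDerivAt_const (0 : ℂ) (0 : ℂ)).congr_of_eventuallyEq (hgp k))
    rw [Finset.sum_add_distrib, ← Finset.mul_sum, ← Finset.mul_sum] at h2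
    linear_combination h2
  · filter_upwards [hinj, hyX, hyg, hne, hsimple, eventually_all.2 hgp] with t h1 h2 h3 h4 h5 h6
    exact ⟨h1, h.moduliMap_eq hn hX h2 h3 h1 fun k => ⟨h4 k, h6 k, h5 k⟩⟩

end TangentEigenvectors

/-! ### Poised subspaces in coordinates. -/

section PoisedSubspaces

variable {W : Type*} [AddCommGroup W] [Module ℂ W] {κ : Type*} [Fintype κ]

theorem diagonalOperator_repr (e : Module.Basis κ ℂ W) (l : κ → ℂ) (v : W) (k : κ) :
    e.repr (diagonalOperator e l v) k = l k * e.repr v k := by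
  classical
  conv_lhs => rw [← e.sum_repr v]
  simp [diagonalOperator, Finsupp.single_apply, mul_comm]

/-- The subspace poised by a pair of forms with the standard basis `e` and the vector `u`. -/
def poisedSubspace (e : Module.Basis κ ℂ W) (l : κ → ℂ) (u : W) : Submodule ℂ W :=
  Submodule.span ℂ {u, diagonalOperator e l u, diagonalOperator e l (diagonalOperator e l u)}

theorem mem_poisedSubspace (e : Module.Basis κ ℂ W) (l : κ → ℂ) (u v : W) :
    v ∈ poisedSubspace e l u ↔ ∃ a b c : ℂ, ∀ k,
      e.repr v k = e.repr u k * (a + b * l k + c * l k ^ 2) := by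
  rw [poisedSubspace, Submodule.mem_span_triple]
  refine exists_congr fun a => exists_congr fun b => exists_congr fun c => ?_
  constructor
  · rintro rfl k
    simp only [map_add, map_smul, Finsupp.add_apply, Finsupp.smul_apply, diagonalOperator_repr,
      smul_eq_mul]
    ring
  · intro h
    refine ext_repr e fun k => ?_
    rw [h]
    simp only [map_add, map_smul, Finsupp.add_apply, Finsupp.smul_apply, diagonalOperator_repr,
      smul_eq_mul]
    ring

theorem finrank_poisedSubspace (e : Module.Basis κ ℂ W) {l : κ → ℂ} (hl : Function.Injective l)
    {u : W} (hu : ∀ k, e.repr u k ≠ 0) (hκ : 3 ≤ Fintype.card κ) :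
    Module.finrank ℂ (poisedSubspace e l u) = 3 := by
  obtain ⟨f⟩ : Nonempty (Fin 3 ↪ κ) := Function.Embedding.nonempty_of_card_le (by simpa using hκ)
  have hli : LinearIndependent ℂ
      ![u, diagonalOperator e l u, diagonalOperator e l (diagonalOperator e l u)] := by
    rw [Fintype.linearIndependent_iff]
    intro z hz
    have hk : ∀ k, z 0 + z 1 * l k + z 2 * l k ^ 2 = 0 := by
      intro k
      have h1 := congrArg (fun v => e.repr v k) hz
      simp only [Fin.sum_univ_three, Matrix.cons_val_zero, Matrix.cons_val_one, Matrix.cons_val,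
        map_add, map_smul, Finsupp.add_apply, Finsupp.smul_apply, diagonalOperator_repr,
        smul_eq_mul, map_zero, Finsupp.zero_apply] at h1
      have h2 : e.repr u k * (z 0 + z 1 * l k + z 2 * l k ^ 2) = 0 := by linear_combination h1
      exact (mul_eq_zero.1 h2).resolve_left (hu k)
    have hf : ∀ i j, i ≠ j → l (f i) - l (f j) ≠ 0 := fun i j hij =>
      sub_ne_zero.2 (hl.ne (f.injective.ne hij))
    have h01 := hf 0 1 (by decide)
    have h02 := hf 0 2 (by decide)
    have h12 := hf 1 2 (by decide)
    have e0 := hk (f 0)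
    have e1 := hk (f 1)
    have e2 := hk (f 2)
    -- Divided differences at three of the roots: a polynomial of degree at most 2 with three
    -- distinct zeros is zero.
    have d1 : z 1 + z 2 * (l (f 0) + l (f 1)) = 0 := by
      refine (mul_eq_zero.1 (?_ : (l (f 0) - l (f 1)) * _ = 0)).resolve_left h01
      linear_combination e0 - e1
    have d2 : z 1 + z 2 * (l (f 0) + l (f 2)) = 0 := by
      refine (mul_eq_zero.1 (?_ : (l (f 0) - l (f 2)) * _ = 0)).resolve_left h02
      linear_combination e0 - e2
    have z2 : z 2 = 0 := by
      refine (mul_eq_zero.1 (?_ : (l (f 1) - l (f 2)) * _ = 0)).resolve_left h12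
      linear_combination d1 - d2
    have z1 : z 1 = 0 := by simpa [z2] using d1
    have z0 : z 0 = 0 := by simpa [z1, z2] using e0
    intro i
    fin_cases i
    · exact z0
    · exact z1
    · exact z2
  have := finrank_span_eq_card hli
  rw [show Set.range ![u, diagonalOperator e l u, diagonalOperator e l (diagonalOperator e l u)] =
    {u, diagonalOperator e l u, diagonalOperator e l (diagonalOperator e l u)} by
      rw [Matrix.range_cons, Matrix.range_cons, Matrix.range_cons, Matrix.range_empty,
        Set.union_empty, Set.singleton_union, Set.singleton_union]] at this
  exact this

theorem isPoisedByPair_poisedSubspace {n : ℕ} (hn : n = Module.finrank ℂ W)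
    (e : Module.Basis (Fin n) ℂ W) {l : Fin n → ℂ} {u : W} (hu : ∀ k, e.repr u k ≠ 0)
    {q₁ q₂ : QuadraticForm ℂ W} (h1 : ∀ z : Fin n → ℂ, q₁ (∑ k, z k • e k) = ∑ k, l k * z k ^ 2)
    (h2 : ∀ z : Fin n → ℂ, q₂ (∑ k, z k • e k) = ∑ k, z k ^ 2) :
    IsPoisedByPair q₁ q₂ (poisedSubspace e l u) := by
  subst hn
  exact ⟨e, l, ⟨h1, h2⟩, u, hu, rfl⟩

end PoisedSubspaces

/-! ### The kernel of the differential of the moduli map. -/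

section Kernel

variable {n : ℕ} {ι : Type*} [Fintype ι]
  {φ₁ φ₂ ψ₁ ψ₂ : QuadraticForm ℂ (Fin (n + 3) → ℂ)}
  {b : Module.Basis ι ℂ (Fin (n + 3) → ℂ)} {α : ι → ℂ} {x : Fin (n + 3) → ℂ}

theorem not_isDegenerate_induced {ψ : QuadraticForm ℂ (Fin (n + 3) → ℂ)}
    {q : QuadraticForm ℂ (TangentSpace φ₁ φ₂ x)}
    (hq : ∀ v w : affineTangent φ₁ φ₂ x,
      QuadraticMap.associated q (tangentClass φ₁ φ₂ v) (tangentClass φ₁ φ₂ w) =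
        QuadraticMap.associated ψ (v : Fin (n + 3) → ℂ) w)
    (hψ : ∀ u ∈ affineTangent φ₁ φ₂ x,
      (∀ w ∈ affineTangent φ₁ φ₂ x, QuadraticMap.associated ψ u w = 0) →
        u ∈ Submodule.span ℂ {x}) : ¬ IsDegenerate q := by
  rintro ⟨U, hU0, hU⟩
  obtain ⟨u, rfl⟩ := Submodule.Quotient.mk_surjective _ U
  refine hU0 ((Submodule.Quotient.mk_eq_zero _).2 (hψ u u.2 fun w hw => ?_))
  rw [← hq u ⟨w, hw⟩]
  exact hU _

theorem moduliPullback_of_mem (hX : IsNonsingularIntersection φ₁ φ₂) (f : ModuliPQ n → ℂ)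
    {y : Fin (n + 3) → ℂ} (hy : y ∈ openLocus φ₁ φ₂) :
    moduliPullback hX f y = f (moduliMap hX ⟨y, hy⟩) :=
  dif_pos hy

/-- The kernel of the differential of the moduli map, in terms of the velocities of the roots of
the discriminant. -/
theorem IsDiagonalFrame.kerDifferential_eq (h : IsDiagonalFrame φ₁ φ₂ ψ₁ ψ₂ b α) (hn : 3 ≤ n)
    (hX : IsNonsingularIntersection φ₁ φ₂) (hx : x ∈ openLocus φ₁ φ₂)
    (hgen : ∀ i, b.repr x i ≠ 0) {l : Fin n → ℂ} (hl : Function.Injective l)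
    (hroot : ∀ k, IsTangentRoot b α x (l k))
    (hperm : ∀ (a b c d : ℂ) (σ : Equiv.Perm (Fin n)), a * d - b * c ≠ 0 →
      (∀ k, l (σ k) * (c * l k + d) = a * l k + b) →
      (5 ≤ n → σ = 1) ∧ (n = 4 → σ * σ = 1))
    {e : Module.Basis (Fin n) ℂ (TangentSpace φ₁ φ₂ x)} {d : Fin n → ℂ}
    (hd : ∀ k, d k ^ 2 = ∑ i, b.repr x i ^ 2 / (α i - l k) ^ 2)
    (he : ∀ (v : affineTangent φ₁ φ₂ x) k, d k * e.repr (tangentClass φ₁ φ₂ v) k =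
      ∑ i, b.repr x i * b.repr (v : Fin (n + 3) → ℂ) i / (α i - l k)) :
    (poisedSubspace e l (∑ k, d k • e k) : Set (TangentSpace φ₁ φ₂ x)) =
      kerDifferential hX ⟨x, hx⟩ := by
  have hn2 : 2 ≤ n := by omega
  have hd0 : ∀ k, d k ≠ 0 := fun k h0 => (hroot k).simple (by rw [← hd, h0]; simp)
  have hud : ∀ k, e.repr (∑ k, d k • e k) k = d k := fun k => by rw [e.repr_sum_self]
  obtain ⟨hx', hclass⟩ := h.moduliMap_eq hn2 hX hx.1 hgen hl hroot
  -- The key relation `l k' = -2 v_k / d k` between root velocities and coordinates of the tangent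
  -- vector, after one factor `d k` is cancelled.
  have hvel : ∀ (v : affineTangent φ₁ φ₂ x) (g' : Fin n → ℂ),
      (∀ k, g' k * ∑ i, b.repr x i ^ 2 / (α i - l k) ^ 2 =
        -2 * ∑ i, b.repr x i * b.repr (v : Fin (n + 3) → ℂ) i / (α i - l k)) →
      ∀ k, g' k * d k = -2 * e.repr (tangentClass φ₁ φ₂ v) k := by
    intro v g' hg' k
    have h1 := hg' k
    rw [← hd, ← he] at h1
    refine mul_right_cancel₀ (hd0 k) ?_
    linear_combination h1
  ext V
  rw [SetLike.mem_coe, mem_poisedSubspace]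
  simp only [hud]
  constructor
  · rintro ⟨a₀, a₁, a₂, hV⟩ f hf y hy hy0 hyX v₀ hv₀ hVv
    have hyd : HasDerivAt y v₀ 0 := hv₀ ▸ hy.differentiableAt.hasDerivAt
    obtain ⟨g, g', hg0, hg, hg', hev⟩ := h.exists_root_curve hn2 hX hgen hl hroot hyd hy0 hyX
    rw [hclass] at hf
    obtain ⟨G', hG, hG'⟩ := fderiv_coefficientPullback_diagonalPair hn2 hl hf
    -- A vector of the poised subspace moves the roots, to first order, along their projective
    -- orbit, where functions on the moduli space have derivative zero.
    have hquad : g' = fun k => -2 * a₀ + -2 * a₁ * l k + -2 * a₂ * l k ^ 2 := by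
      ext k
      have h1 := hvel v₀ g' hg' k
      rw [hVv, hV k] at h1
      refine mul_right_cancel₀ (hd0 k) ?_
      linear_combination h1
    have h1 : HasDerivAt (fun t => coefficientPullback f (diagonalPair (g t))) (G' g') 0 := by
      rw [← hg0] at hG
      exact hG.comp_hasDerivAt (0 : ℂ) hg
    rw [hquad, hG'] at h1
    refine h1.congr_of_eventuallyEq ?_
    filter_upwards [hev] with t ht
    obtain ⟨hgt, hyt, hcl⟩ := ht
    rw [moduliPullback_of_mem hX f hyt, hcl, coefficientPullback_diagonalPair hn2 hgt]
  · intro hV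
    obtain ⟨v, rfl⟩ := Submodule.Quotient.mk_surjective _ V
    by_contra hnot
    obtain ⟨y, w, hy, -, hy0, -, hyv, hyX⟩ := h.exists_curve hx.1 hgen v.2 v.2
    have hyX' := hyX.mono fun t ht => ht.1
    have hyd : HasDerivAt y v 0 := hyv ▸ hy.differentiableAt.hasDerivAt
    obtain ⟨g, g', hg0, hg, hg', hev⟩ := h.exists_root_curve hn2 hX hgen hl hroot hyd hy0 hyX'
    -- A vector outside the poised subspace gives a root velocity transverse to the orbit, which
    -- some invariant detects. The factor `-1/2` inverts the `-2` of `hvel`.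
    have hquad : ¬ ∃ a b c : ℂ, ∀ k, g' k = a + b * l k + c * l k ^ 2 := by
      rintro ⟨a, b, c, habc⟩
      refine hnot ⟨-a / 2, -b / 2, -c / 2, fun k => ?_⟩
      have h1 := hvel v g' hg' k
      rw [habc] at h1
      linear_combination (1 / 2 : ℂ) * h1
    obtain ⟨F, hFinv, hFd, hF⟩ := exists_invariant_derivative_ne_zero hn hl hperm hquad
    obtain ⟨f, hf, hfF⟩ := exists_holomorphic_of_moebius_invariant hn2 F hFinv hFd
    obtain ⟨D, hD0, hD⟩ := hF g hg0 hg
    have h1 := hV f (hf _) y hy hy0 hyX' v hyv rfl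
    refine hD0 (hD.unique (h1.congr_of_eventuallyEq ?_))
    filter_upwards [hev] with t ht
    obtain ⟨hgt, hyt, hcl⟩ := ht
    rw [moduliPullback_of_mem hX f hyt, hcl, hfF]

end Kernel

end PencilsOfQuadrics

theorem theoremt71 {n : ℕ} (hn : 3 ≤ n) (φ₁ φ₂ : QuadraticForm ℂ (Fin (n + 3) → ℂ))
    (hX : PencilsOfQuadrics.IsNonsingularIntersection φ₁ φ₂)
    (x : Fin (n + 3) → ℂ) (hx : PencilsOfQuadrics.IsRegularPoint φ₁ φ₂ x) :
    ∃ P : Submodule ℂ (PencilsOfQuadrics.TangentSpace φ₁ φ₂ x),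
      (P : Set (PencilsOfQuadrics.TangentSpace φ₁ φ₂ x)) =
        PencilsOfQuadrics.kerDifferential hX ⟨x, hx.mem_openLocus⟩ ∧
      Module.finrank ℂ P = 3 ∧
      PencilsOfQuadrics.IsPoised (PencilsOfQuadrics.secondFundamentalForm φ₁ φ₂ x) P := by
  obtain ⟨ψ₁, ψ₂, hgood, ⟨b, α, hstd, hgen⟩, hnd⟩ := hx.general
  have hframe : PencilsOfQuadrics.IsDiagonalFrame φ₁ φ₂ ψ₁ ψ₂ b α :=
    ⟨hgood.span_eq, PencilsOfQuadrics.associated_eq_of_standard b hstd.1, fun u v => by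
      have := PencilsOfQuadrics.associated_eq_of_standard b (ψ := ψ₂) (α := 1)
        (fun z => by simpa using hstd.2 z) u v
      simpa using this⟩
  have hW := PencilsOfQuadrics.finrank_tangentSpace hX hx.mem_cone
  obtain ⟨q₁, q₂, hq⟩ := hframe.exists_isInducedPair hx.mem_cone
  have hq₁ := PencilsOfQuadrics.not_isDegenerate_induced hq.eq₁ (hnd ψ₁ (by simp))
  have hq₂ := PencilsOfQuadrics.not_isDegenerate_induced hq.eq₂ (hnd ψ₂ (by simp))
  obtain ⟨l, hl, hroot⟩ := hframe.exists_isTangentRoot (by omega) hX hx.mem_cone hgen hq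
    hx.nonsingular hq₂
  obtain ⟨e, d, hd, he, he1, he2⟩ := hframe.exists_tangent_basis hX hx.mem_cone hq hl.injective
    hroot
  -- The poising vector `∑ d k e k` is general because the roots are simple: `d k ^ 2` is the sum
  -- that `IsTangentRoot.simple` keeps from vanishing.
  have hu : ∀ k, e.repr (∑ k, d k • e k) k ≠ 0 := by
    intro k h0
    rw [e.repr_sum_self] at h0
    exact (hroot k).simple (by rw [← hd, h0]; simp)
  have h3 := PencilsOfQuadrics.finrank_poisedSubspace e hl.injective hu (by simpa using hn)
  refine ⟨_, hframe.kerDifferential_eq hn hX hx.mem_openLocus hgen hl.injective hroot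
    (fun a b c d σ hdet hσ => hl.perm_eq_of_isGeneralPencil (by omega) hW hx.generalPencil hdet hσ)
    hd he, h3, h3, q₁, q₂, ⟨hl.linearIndependent (by omega), hq₁, hq₂, hl.span_eq,
    hx.nonsingular⟩, PencilsOfQuadrics.isPoisedByPair_poisedSubspace hW.symm e hu he1 he2⟩
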